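/- **Theorem 1 (Parallel Hamiltonian simulation).** Let $A_1,\dots,A_Q$ be Hermitian $N\times N$ matrices with $|(A_q)_{jk}|\le M$ for all $q,j,k$ (for instance $M=M_A$, the largest absolute value of an entry of these matrices), let $t\in\mathbb R$ and $\varepsilon>0$. Suppose that the entries are accessible through a quantum oracle $$|q\rangle|j\rangle|k\rangle|s\rangle\mapsto|q\rangle|j\rangle|k\rangle|s\oplus z_{q,jk}\rangle ,$$ where $z_{q,jk}$ is a binary word that holds $(A_q)_{jk}$ in fixed-point format (two's complement for the real and the imaginary part, with a known unit), exactly or with an error $\delta$ such that $8|t|\delta\le\varepsilon$, and where the oracle acts trivially on out-of-range addresses. Suppose that the oracle is efficient: one call takes time $\tau=O(\mathrm{polylog}(N^2Q))$, and $\tau$ is at least the number of output bits. Then the unitary operation $$U=\sum_{q=1}^{Q}|q\rangle\langle q|\otimes e^{-i\frac{A_q}{N}t}\qquad\text{on } \mathbb C^Q\otimes\mathbb C^N,$$ where $|1\rangle,\dots,|Q\rangle$ is the computational basis of $\mathbb C^Q$, can be simulated within spectral-norm error $\varepsilon$ in time $$O\!\left(\max\{1,M^2t^2/\varepsilon\}\,\mathrm{polylog}(N^2Q)\right),$$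 that is, in time $O(M_A^2t^2\,\mathrm{polylog}(N^2Q)/\varepsilon)$ when $M=M_A$ and $M_A^2t^2\ge\varepsilon$. In detail: $\mathrm{polylog}(x)$ stands for a bound $c\,(1+\log x)^k$. For all $c_0,k_0$ there are $C,k$ such that for all $Q,N\ge1$, all word lengths, units, $M,t,\varepsilon$ and all $\tau\le c_0(1+\log(N^2Q))^{k_0}$ as above there is a quantum circuit, the same for all admissible $A_1,\dots,A_Q$ and all oracles for them, with the following properties. It acts on qubits that hold $|q\rangle|j\rangle$ in binary and on ancilla qubits in the state $|0\cdots0\rangle$, which are discarded at the end, and it consists of oracle calls and of one-qubit unitaries with at most two control qubits. Its time, in which each ancilla and each gate counts $1$ and each oracle call counts $\tau$, is at most $C\max\{1,M^2t^2/\varepsilon\}(1+\log(N^2Q))^k$. For every density matrix $\sigma$ on $\mathbb C^r\otimes\mathbb C^Q\otimes\mathbb C^N$, with a reference system $\mathbb C^r$ of any finite dimension on which the circuit does not act, the output differs from $(I\otimes U)\sigma(I\otimes U)^\dagger$ by at most $\varepsilon$ in spectral norm. -/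

import Mathlib

/-! Quantum circuits with an entry oracle for a list of matrices, and the channels they realize. -/

namespace ParHamSim

open scoped Kronecker Matrix

/-- The `m` lowest binary digits of `j`: the computational basis label of `j` in `m` qubits. -/
def label (m j : ℕ) : Fin m → Bool := fun i => j.testBit i

/-- The number of qubits of a register whose basis states are labelled by `0, …, n - 1`. -/
def width (n : ℕ) : ℕ := Nat.clog 2 n

/-- A complex number in fixed-point format: the words of its real and of its imaginary part, each
with `b + 1` bits. -/
abbrev Word (b : ℕ) : Type := (Fin (b + 1) → Bool) × (Fin (b + 1) → Bool)

/-- The real number that a word of `b + 1` bits stands for: a two's complement integer, multiplied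
by the unit `u` of the format. -/
noncomputable def fixedPoint (u : ℝ) {b : ℕ} (z : Fin (b + 1) → Bool) : ℝ :=
  u * ((∑ i : Fin b, if z i.castSucc then (2 : ℝ) ^ (i : ℕ) else 0)
    - if z (Fin.last b) then (2 : ℝ) ^ b else 0)

/-- The complex number that a word stands for. -/
noncomputable def Word.value (u : ℝ) {b : ℕ} (z : Word b) : ℂ :=
  ⟨fixedPoint u z.1, fixedPoint u z.2⟩

/-- The stored entries of `Q` matrices of size `N × N`. -/
abbrev Table (Q N b : ℕ) : Type := Fin Q → Fin N → Fin N → Word b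

/-- The word at the address `(x, y, z)`, three strings of qubit values; it is zero if the address is
out of range. -/
def Table.lookup {Q N b : ℕ} (Z : Table Q N b) (x : Fin (width Q) → Bool)
    (y z : Fin (width N) → Bool) : Word b :=
  if h : Nat.ofBits x < Q ∧ Nat.ofBits y < N ∧ Nat.ofBits z < N then
    Z ⟨Nat.ofBits x, h.1⟩ ⟨Nat.ofBits y, h.2.1⟩ ⟨Nat.ofBits z, h.2.2⟩
  else (fun _ => false, fun _ => false)

/-- The qubits on which the oracle acts: the address registers (number of the matrix, row, column)
and the two output registers. -/
inductive OracleWire (Q N b : ℕ) : Type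
  | block (i : Fin (width Q))
  | row (i : Fin (width N))
  | col (i : Fin (width N))
  | re (i : Fin (b + 1))
  | im (i : Fin (b + 1))

/-- The gates on qubits indexed by `W`: an arbitrary one-qubit unitary with at most two control
qubits (in particular all one-qubit gates, CNOT and Toffoli), and the oracle, applied to any choice
of distinct qubits. -/
inductive Gate (Q N b : ℕ) (W : Type) : Type
  | elementary (controls : Finset W) (card_le : controls.card ≤ 2) (target : W)
      (notMem : target ∉ controls) (U : Matrix.unitaryGroup Bool ℂ)
  | oracle (place : OracleWire Q N b ↪ W)

section Semantics

variable {Q N b : ℕ} {W : Type} [Fintype W] [DecidableEq W]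

/-- The matrix of a gate in the computational basis. The oracle is the permutation
`|q⟩|j⟩|k⟩|s⟩ ↦ |q⟩|j⟩|k⟩|s ⊕ Z q j k⟩`. -/
noncomputable def Gate.toMatrix (Z : Table Q N b) : Gate Q N b W → Matrix (W → Bool) (W → Bool) ℂ
  | .elementary controls _ target _ U => Matrix.of fun x y =>
      if ∀ i ∈ controls, x i = true then
        if ∀ i, i ≠ target → x i = y i then (U : Matrix Bool Bool ℂ) (x target) (y target) else 0
      else if x = y then 1 else 0
  | .oracle place => Matrix.of fun x y =>
      let s := Z.lookup (fun i => y (place (.block i))) (fun i => y (place (.row i)))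
        (fun i => y (place (.col i)))
      if (∀ i, x (place (.re i)) = xor (y (place (.re i))) (s.1 i)) ∧
          (∀ i, x (place (.im i)) = xor (y (place (.im i))) (s.2 i)) ∧
          (∀ w, (∀ i, w ≠ place (.re i)) → (∀ i, w ≠ place (.im i)) → x w = y w)
      then 1 else 0

/-- The unitary of a sequence of gates; the head of the list is applied first. -/
noncomputable def listMatrix (Z : Table Q N b) :
    List (Gate Q N b W) → Matrix (W → Bool) (W → Bool) ℂ
  | [] => 1
  | g :: l => listMatrix Z l * g.toMatrix Z

end Semantics

/-- The time of a gate: `τ` for the oracle, one for every other gate. -/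
def Gate.time (τ : ℕ) {Q N b : ℕ} {W : Type} : Gate Q N b W → ℕ
  | .elementary .. => 1
  | .oracle _ => τ

/-- The qubits that hold the input and the output, a state of `ℂ^Q ⊗ ℂ^N`. -/
abbrev SysWire (Q N : ℕ) : Type := Fin (width Q) ⊕ Fin (width N)

/-- A circuit on the qubits of the system and on some ancilla qubits. It does not contain the
table: the same circuit is run with different oracles. -/
structure Circuit (Q N b : ℕ) where
  ancillas : ℕ
  gates : List (Gate Q N b (SysWire Q N ⊕ Fin ancillas))

/-- The running time when an oracle call takes time `τ`: every ancilla qubit (for its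
initialization) and every elementary gate takes one unit of time. -/
def Circuit.time (τ : ℕ) {Q N b : ℕ} (c : Circuit Q N b) : ℕ :=
  c.ancillas + (c.gates.map (Gate.time τ)).sum

/-- The computational basis state of the system qubits that represents `|q⟩|j⟩`. -/
def sysLabel {Q N : ℕ} (p : Fin Q × Fin N) : SysWire Q N → Bool :=
  Sum.elim (label (width Q) p.1) (label (width N) p.2)

/-- The operator `σ` on `ℂ^r ⊗ ℂ^Q ⊗ ℂ^N`, as an operator on `ℂ^r` and the system qubits. -/
noncomputable def encode {r Q N : ℕ}
    (σ : Matrix (Fin r × (Fin Q × Fin N)) (Fin r × (Fin Q × Fin N)) ℂ) :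
    Matrix (Fin r × (SysWire Q N → Bool)) (Fin r × (SysWire Q N → Bool)) ℂ :=
  let J : Matrix (SysWire Q N → Bool) (Fin Q × Fin N) ℂ :=
    Matrix.of fun x p => if x = sysLabel p then 1 else 0
  ((1 : Matrix (Fin r) (Fin r) ℂ) ⊗ₖ J) * σ * ((1 : Matrix (Fin r) (Fin r) ℂ) ⊗ₖ J)ᴴ

/-- Adjoin ancilla qubits in the state `|0⋯0⟩`. -/
noncomputable def adjoinZeros {r a : ℕ} {S : Type}
    (ω : Matrix (Fin r × (S → Bool)) (Fin r × (S → Bool)) ℂ) :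
    Matrix (Fin r × (S ⊕ Fin a → Bool)) (Fin r × (S ⊕ Fin a → Bool)) ℂ :=
  Matrix.of fun x y =>
    if (∀ i, x.2 (.inr i) = false) ∧ (∀ i, y.2 (.inr i) = false) then
      ω (x.1, fun w => x.2 (.inl w)) (y.1, fun w => y.2 (.inl w))
    else 0

/-- The partial trace over the ancilla qubits. -/
noncomputable def traceAncillas {r a : ℕ} {S : Type}
    (ω : Matrix (Fin r × (S ⊕ Fin a → Bool)) (Fin r × (S ⊕ Fin a → Bool)) ℂ) :
    Matrix (Fin r × (S → Bool)) (Fin r × (S → Bool)) ℂ :=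
  Matrix.of fun x y =>
    ∑ z : Fin a → Bool, ω (x.1, Sum.elim x.2 z) (y.1, Sum.elim y.2 z)

/-- The output of the circuit on the input `σ`: encode `σ` in the system qubits, adjoin the ancillas,
apply the gates, discard the ancillas. The factor `ℂ^r` is a reference system, on which the circuit
does not act. -/
noncomputable def Circuit.output {Q N b : ℕ} (c : Circuit Q N b) (Z : Table Q N b) {r : ℕ}
    (σ : Matrix (Fin r × (Fin Q × Fin N)) (Fin r × (Fin Q × Fin N)) ℂ) :
    Matrix (Fin r × (SysWire Q N → Bool)) (Fin r × (SysWire Q N → Bool)) ℂ :=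
  let V := (1 : Matrix (Fin r) (Fin r) ℂ) ⊗ₖ listMatrix Z c.gates
  traceAncillas (V * adjoinZeros (encode σ) * Vᴴ)

open scoped Matrix.Norms.L2Operator in
/-- The spectral norm of a matrix. -/
noncomputable def spectralNorm {n : Type} [Fintype n] [DecidableEq n] (M : Matrix n n ℂ) : ℝ := ‖M‖

open scoped ComplexOrder in
/-- Run with the table `Z`, the circuit simulates the unitary operation `U` on `ℂ^Q ⊗ ℂ^N` within
spectral-norm error `ε`: on every density matrix `σ`, also of a system that is entangled with a
reference system, its output differs from `U σ U†` by at most `ε` in spectral norm. -/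
def Circuit.Simulates {Q N b : ℕ} (c : Circuit Q N b) (Z : Table Q N b)
    (U : Matrix (Fin Q × Fin N) (Fin Q × Fin N) ℂ) (ε : ℝ) : Prop :=
  ∀ (r : ℕ) (σ : Matrix (Fin r × (Fin Q × Fin N)) (Fin r × (Fin Q × Fin N)) ℂ),
    σ.PosSemidef → σ.trace = 1 →
      spectralNorm (c.output Z σ -
        encode (((1 : Matrix (Fin r) (Fin r) ℂ) ⊗ₖ U) * σ *
          ((1 : Matrix (Fin r) (Fin r) ℂ) ⊗ₖ U)ᴴ)) ≤ ε

/-- The largest absolute value of an entry of the matrices. -/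
noncomputable def maxAbsEntry {Q N : ℕ} (A : Fin Q → Matrix (Fin N) (Fin N) ℂ) : ℝ :=
  ⨆ p : Fin Q × Fin N × Fin N, ‖A p.1 p.2.1 p.2.2‖

/-- The operation `∑ q, |q⟩⟨q| ⊗ exp (-i (A q / N) t)`. -/
noncomputable def parallelEvolution {Q N : ℕ} (A : Fin Q → Matrix (Fin N) (Fin N) ℂ) (t : ℝ) :
    Matrix (Fin Q × Fin N) (Fin Q × Fin N) ℂ :=
  ∑ q, Matrix.single q q (1 : ℂ) ⊗ₖ NormedSpace.exp ((-Complex.I * (t / N : ℂ)) • A q)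

end ParHamSim

/-!
The bitwise sum of the row and column indices of a matrix entry is its displacement. Once the
displacement is put into an ancilla register, every row has exactly one entry, and the matrix
becomes one-sparse. A flag that says whether the row index has been shifted by the displacement
makes this one-sparse operator a Hermitian exchange of pairs of basis states: each pair owns one
entry, which a single oracle call delivers, and the evolution of the pairs is a rotation of the
flag by an angle that is linear in the digits of the entry. In the uniform superposition of
displacement and flag, the expectation of the one-sparse operator is `2 ^ (-width N)` times the
original matrix.

So a step with fresh ancillas in the uniform superposition acts on an observable, to first order
in the angles, like the evolution with the generator `A_q`, and its error is of second order,
hence `O((M t / n) ^ 2)` when `n` steps are made. The dual channel of a step is a contraction;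
therefore the errors of the steps add up, to `O(M ^ 2 t ^ 2 / n)`, and `n = O(M ^ 2 t ^ 2 / ε)`
steps suffice. The duality of operator norm and trace norm turns this bound for observables into
one for states.
-/

namespace ParHamSim

open scoped Kronecker Matrix Matrix.Norms.L2Operator

section OperatorNorm

variable {m n p : Type*} [Fintype m] [Fintype n] [Fintype p]

theorem trace_mul_conjTranspose_self (X : Matrix m n ℂ) :
    (X * Xᴴ).trace = ((∑ i, ∑ j, ‖X i j‖ ^ 2 : ℝ) : ℂ) := by
  simp [Matrix.trace, Matrix.mul_apply, Complex.mul_conj, Complex.normSq_eq_norm_sq]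

variable [DecidableEq n]

theorem norm_le_one_of_conjTranspose_mul_self {V : Matrix m n ℂ} (hV : Vᴴ * V = 1) : ‖V‖ ≤ 1 := by
  rcases subsingleton_or_nontrivial (Matrix n n ℂ) with h | h
  · have : ‖V‖ * ‖V‖ = 0 := by
      rw [← Matrix.l2_opNorm_conjTranspose_mul_self, Subsingleton.elim (Vᴴ * V) 0, norm_zero]
    rw [mul_self_eq_zero.1 this]
    exact zero_le_one
  · have : ‖V‖ * ‖V‖ = 1 := by
      rw [← Matrix.l2_opNorm_conjTranspose_mul_self, hV, norm_one]
    nlinarith [norm_nonneg V]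

theorem norm_pow_le_one {V : Matrix n n ℂ} (hV : ‖V‖ ≤ 1) : ∀ k : ℕ, ‖V ^ k‖ ≤ 1
  | 0 => norm_le_one_of_conjTranspose_mul_self (by simp)
  | k + 1 => (norm_pow_le' V k.succ_pos).trans (pow_le_one₀ (norm_nonneg V) hV)

theorem norm_conjTranspose_mul_mul_le [DecidableEq m] {V : Matrix m n ℂ} (hV : ‖V‖ ≤ 1)
    (X : Matrix m m ℂ) : ‖Vᴴ * X * V‖ ≤ ‖X‖ :=
  calc ‖Vᴴ * X * V‖ ≤ ‖Vᴴ‖ * ‖X‖ * ‖V‖ :=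
        (Matrix.l2_opNorm_mul _ _).trans (by gcongr; exact Matrix.l2_opNorm_mul _ _)
    _ ≤ 1 * ‖X‖ * 1 := by rw [Matrix.l2_opNorm_conjTranspose]; gcongr
    _ = ‖X‖ := by ring

theorem norm_sq_le_sum_norm_sq (X : Matrix m n ℂ) : ‖X‖ ^ 2 ≤ ∑ i, ∑ j, ‖X i j‖ ^ 2 := by
  have h0 : 0 ≤ ∑ i, ∑ j, ‖X i j‖ ^ 2 := by positivity
  suffices ‖X‖ ≤ √(∑ i, ∑ j, ‖X i j‖ ^ 2) by
    simpa [Real.sq_sqrt h0] using pow_le_pow_left₀ (norm_nonneg X) this 2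
  rw [Matrix.l2_opNorm_def]
  refine ContinuousLinearMap.opNorm_le_bound _ (Real.sqrt_nonneg _) fun v => ?_
  refine (sq_le_sq₀ (norm_nonneg _) (by positivity)).1 ?_
  rw [mul_pow, Real.sq_sqrt h0, EuclideanSpace.norm_sq_eq, EuclideanSpace.norm_sq_eq,
    Finset.sum_mul]
  refine Finset.sum_le_sum fun i _ => ?_
  calc ‖∑ j, X i j * v j‖ ^ 2 ≤ (∑ j, ‖X i j‖ * ‖v j‖) ^ 2 := by
        gcongr
        exact (norm_sum_le _ _).trans_eq (Finset.sum_congr rfl fun j _ => norm_mul _ _)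
    _ ≤ (∑ j, ‖X i j‖ ^ 2) * ∑ j, ‖v j‖ ^ 2 := Finset.sum_mul_sq_le_sq_mul_sq _ _ _

theorem norm_le_of_norm_trace_mul_le [DecidableEq m] {X : Matrix m n ℂ} {c : ℝ}
    (hc : 0 ≤ c) (h : ∀ Y : Matrix n m ℂ, ‖(X * Y).trace‖ ≤ c * ‖Y‖) : ‖X‖ ≤ c := by
  have hsq : ‖X‖ * ‖X‖ ≤ c * ‖X‖ :=
    calc ‖X‖ * ‖X‖ = ‖X‖ ^ 2 := (sq _).symm
      _ ≤ ‖(X * Xᴴ).trace‖ := by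
          rw [trace_mul_conjTranspose_self, Complex.norm_real]
          exact (norm_sq_le_sum_norm_sq X).trans (le_abs_self _)
      _ ≤ c * ‖X‖ := Matrix.l2_opNorm_conjTranspose X ▸ h Xᴴ
  rcases (norm_nonneg X).eq_or_lt with h0 | h0
  · exact h0 ▸ hc
  · exact le_of_mul_le_mul_right hsq h0

theorem norm_trace_mul_mul_conjTranspose_le (X : Matrix n n ℂ) (E : Matrix n p ℂ) :
    ‖(X * (E * Eᴴ)).trace‖ ≤ ‖X‖ * ∑ i, ∑ j, ‖E i j‖ ^ 2 := by
  let e (j : p) : EuclideanSpace ℂ n := WithLp.toLp 2 (E.col j)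
  have htrace : (X * (E * Eᴴ)).trace =
      ∑ j, inner ℂ (e j) (Matrix.toEuclideanCLM (𝕜 := ℂ) X (e j)) := by
    rw [← Matrix.mul_assoc, Matrix.trace_mul_comm, Matrix.trace]
    refine Finset.sum_congr rfl fun j _ => ?_
    rw [Matrix.diag_apply, Matrix.toEuclideanCLM_toLp, EuclideanSpace.inner_toLp_toLp,
      dotProduct_comm, Matrix.mul_apply]
    rfl
  have hterm (j : p) : ‖inner ℂ (e j) (Matrix.toEuclideanCLM (𝕜 := ℂ) X (e j))‖ ≤
      ‖X‖ * ∑ i, ‖E i j‖ ^ 2 :=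
    calc _ ≤ ‖e j‖ * ‖Matrix.toEuclideanCLM (𝕜 := ℂ) X (e j)‖ := norm_inner_le_norm _ _
      _ ≤ ‖e j‖ * (‖X‖ * ‖e j‖) := by gcongr; exact Matrix.l2_opNorm_mulVec X (e j)
      _ = ‖X‖ * ‖e j‖ ^ 2 := by ring
      _ = ‖X‖ * ∑ i, ‖E i j‖ ^ 2 := by rw [EuclideanSpace.norm_sq_eq]; rfl
  rw [htrace, Finset.sum_comm, Finset.mul_sum]
  exact (norm_sum_le _ _).trans (Finset.sum_le_sum fun j _ => hterm j)

open scoped ComplexOrder MatrixOrder in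
theorem norm_trace_mul_le_of_posSemidef (X : Matrix n n ℂ) {σ : Matrix n n ℂ} (hσ : σ.PosSemidef)
    (htr : σ.trace = 1) : ‖(X * σ).trace‖ ≤ ‖X‖ := by
  obtain ⟨B, rfl⟩ := CStarAlgebra.nonneg_iff_eq_mul_star_self.1 hσ.nonneg
  rw [Matrix.star_eq_conjTranspose] at htr ⊢
  have h1 : ∑ i, ∑ j, ‖B i j‖ ^ 2 = 1 := by
    exact_mod_cast (trace_mul_conjTranspose_self B).symm.trans htr
  simpa [h1] using norm_trace_mul_mul_conjTranspose_le X B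

end OperatorNorm

section Amplification

/-- The operator `1 ⊗ X`, the action of `X` in the presence of a reference system with basis `R`. -/
def amplify (R : Type*) [DecidableEq R] {m n : Type*} (X : Matrix m n ℂ) :
    Matrix (R × m) (R × n) ℂ :=
  (1 : Matrix R R ℂ) ⊗ₖ X

variable {R l m n : Type*} [DecidableEq R]

theorem amplify_apply (X : Matrix m n ℂ) (x : R × m) (y : R × n) :
    amplify R X x y = if x.1 = y.1 then X x.2 y.2 else 0 := by
  simp [amplify, Matrix.one_apply]

theorem amplify_sub (X Y : Matrix m n ℂ) : amplify R (X - Y) = amplify R X - amplify R Y := by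
  rw [amplify, sub_eq_add_neg, Matrix.kronecker_add, ← neg_one_smul ℂ Y, Matrix.kronecker_smul,
    neg_one_smul, ← sub_eq_add_neg, amplify, amplify]

theorem amplify_one [DecidableEq n] : amplify R (1 : Matrix n n ℂ) = 1 :=
  Matrix.one_kronecker_one

theorem amplify_conjTranspose (X : Matrix m n ℂ) : amplify R Xᴴ = (amplify R X)ᴴ := by
  rw [amplify, amplify, Matrix.conjTranspose_kronecker, Matrix.conjTranspose_one]

variable [Fintype R] [Fintype m]

theorem amplify_mul (X : Matrix l m ℂ) (Y : Matrix m n ℂ) :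
    amplify R (X * Y) = amplify R X * amplify R Y := by
  rw [amplify, amplify, amplify, ← Matrix.mul_kronecker_mul, one_mul]

variable [Fintype n] [DecidableEq n]

theorem norm_amplify_le_of_square (X : Matrix n n ℂ) : ‖amplify R X‖ ≤ ‖X‖ :=
  let φ : Matrix n n ℂ →⋆ₙₐ[ℂ] Matrix (R × n) (R × n) ℂ :=
    { toFun := amplify R
      map_smul' := fun c X => Matrix.kronecker_smul c 1 X
      map_zero' := Matrix.kronecker_zero _
      map_add' := Matrix.kronecker_add 1
      map_mul' := amplify_mul
      map_star' := amplify_conjTranspose }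
  NonUnitalStarAlgHom.norm_apply_le φ X

theorem norm_amplify_le (X : Matrix m n ℂ) : ‖amplify R X‖ ≤ ‖X‖ := by
  refine (mul_self_le_mul_self_iff (norm_nonneg _) (norm_nonneg _)).2 ?_
  rw [← Matrix.l2_opNorm_conjTranspose_mul_self, ← amplify_conjTranspose, ← amplify_mul,
    ← Matrix.l2_opNorm_conjTranspose_mul_self]
  exact norm_amplify_le_of_square _

end Amplification

section BasisMap

variable {α β γ ι : Type*} [DecidableEq β] [DecidableEq γ]

/-- The matrix that maps the basis state `x` to the basis state `F x`. -/
def basisMap (F : α → β) : Matrix β α ℂ := Matrix.of fun y x => if y = F x then 1 else 0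

theorem basisMap_apply (F : α → β) (y : β) (x : α) : basisMap F y x = if y = F x then 1 else 0 :=
  rfl

theorem basisMap_id : basisMap (id : β → β) = 1 := by
  ext x y
  simp [basisMap_apply, Matrix.one_apply]

theorem mul_basisMap_apply [Fintype β] (X : Matrix ι β ℂ) (F : α → β) (i : ι) (x : α) :
    (X * basisMap F) i x = X i (F x) := by
  simp [Matrix.mul_apply, basisMap_apply]

theorem basisMap_mul_apply_of_injective [Fintype α] {F : α → β} (hF : F.Injective)
    (X : Matrix α ι ℂ) (x : α) (i : ι) : (basisMap F * X) (F x) i = X x i := by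
  classical
  simp [Matrix.mul_apply, basisMap_apply, hF.eq_iff]

theorem basisMap_mul_apply_of_notMem_range [Fintype α] {F : α → β} {y : β} (hy : y ∉ Set.range F)
    (X : Matrix α ι ℂ) (i : ι) : (basisMap F * X) y i = 0 := by
  have h (x : α) : y ≠ F x := fun e => hy ⟨x, e.symm⟩
  simp [Matrix.mul_apply, basisMap_apply, h]

theorem basisMap_mul_basisMap [Fintype β] (F : β → γ) (G : α → β) :
    basisMap F * basisMap G = basisMap (F ∘ G) := by
  ext x y
  exact mul_basisMap_apply _ _ _ _

theorem diagonal_mul_basisMap [Fintype α] [DecidableEq α] [Fintype β] (g : β → ℂ) (F : α → β) :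
    Matrix.diagonal g * basisMap F = basisMap F * Matrix.diagonal (g ∘ F) := by
  ext y x
  rw [Matrix.diagonal_mul, Matrix.mul_diagonal, basisMap_apply]
  split_ifs with h
  · rw [h, mul_comm, Function.comp_apply]
  · rw [mul_zero, zero_mul]

theorem conjTranspose_basisMap_mul_self [DecidableEq α] [Fintype β] {F : α → β}
    (hF : F.Injective) : (basisMap F)ᴴ * basisMap F = 1 := by
  ext x y
  simp [mul_basisMap_apply, basisMap_apply, Matrix.one_apply, hF.eq_iff, eq_comm]

theorem submatrix_eq_conjTranspose_basisMap_mul_mul [Fintype β] (X : Matrix β β ℂ)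
    (F : α → β) : X.submatrix F F = (basisMap F)ᴴ * X * basisMap F := by
  ext x y
  simp [Matrix.mul_apply, basisMap_apply]

theorem norm_basisMap_le [Fintype α] [DecidableEq α] [Fintype β] {F : α → β} (hF : F.Injective) :
    ‖basisMap F‖ ≤ 1 :=
  norm_le_one_of_conjTranspose_mul_self (conjTranspose_basisMap_mul_self hF)

theorem norm_submatrix_le [Fintype α] [DecidableEq α] [Fintype β] {F : α → β} (hF : F.Injective)
    (X : Matrix β β ℂ) : ‖X.submatrix F F‖ ≤ ‖X‖ := by
  rw [submatrix_eq_conjTranspose_basisMap_mul_mul]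
  exact norm_conjTranspose_mul_mul_le (norm_basisMap_le hF) X

end BasisMap

section Rotation

variable {α β : Type*} [Fintype α] [Fintype β] [DecidableEq α] [DecidableEq β]

/-- The function `p` describes a rotation axis in the equatorial plane of the Bloch sphere, by the
off-diagonal entries `p c` in row `c` of the skew-Hermitian unitary one-qubit matrix that generates
the rotations about it. -/
def IsAxis (p : Bool → ℂ) : Prop := ∀ c, p c * p (!c) = -1 ∧ star (p c) = -p (!c)

/-- The direct sum of rotations about the axis `p` of the pairs of basis states that are exchanged
by the involution `F`; the bit `a` tells the two states of a pair apart. -/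
noncomputable def rotation (F : α → α) (a : α → Bool) (p : Bool → ℂ) (θ : α → ℝ) : Matrix α α ℂ :=
  Matrix.diagonal (fun y => (Real.cos (θ y) : ℂ)) +
    Matrix.diagonal (fun y => p (a y) * (Real.sin (θ y) : ℂ)) * basisMap F

theorem rotation_zero (F : α → α) (a : α → Bool) (p : Bool → ℂ) :
    rotation F a p (fun _ => 0) = 1 := by
  simp [rotation]

theorem rotation_mul_basisMap {F : β → β} {G : α → α} {L : α → β} (h : F ∘ L = L ∘ G)
    (a : β → Bool) (p : Bool → ℂ) (θ : β → ℝ) :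
    rotation F a p θ * basisMap L = basisMap L * rotation G (a ∘ L) p (θ ∘ L) := by
  rw [rotation, rotation, Matrix.add_mul, Matrix.mul_add, Matrix.mul_assoc, basisMap_mul_basisMap,
    h, ← basisMap_mul_basisMap, ← Matrix.mul_assoc, diagonal_mul_basisMap, diagonal_mul_basisMap,
    Matrix.mul_assoc]
  rfl

theorem rotation_mul_apply {ι : Type*} {F : α → α} (hF : F.Involutive) (a : α → Bool)
    (p : Bool → ℂ) (θ : α → ℝ) (X : Matrix α ι ℂ) (x : α) (i : ι) :
    (rotation F a p θ * X) x i = Real.cos (θ x) * X x i + p (a x) * Real.sin (θ x) * X (F x) i := by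
  have h := basisMap_mul_apply_of_injective hF.injective X (F x) i
  rw [hF x] at h
  rw [rotation, Matrix.add_mul, Matrix.add_apply, Matrix.diagonal_mul, Matrix.mul_assoc,
    Matrix.diagonal_mul, h]

variable {F : α → α} (hF : F.Involutive) {a : α → Bool} (ha : ∀ y, a (F y) = !a y) {p : Bool → ℂ}
  (hp : IsAxis p)
include hF ha hp

theorem rotation_mul_rotation {θ θ' : α → ℝ} (hθ : ∀ y, θ (F y) = θ y) :
    rotation F a p θ' * rotation F a p θ = rotation F a p (θ' + θ) := by
  have hpp (x : α) : p (a x) * p (!a x) = -1 := (hp _).1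
  have hfix (x : α) : F x ≠ x := ne_of_apply_ne a (by simp [ha])
  ext x y
  have hswap : F x = y ↔ x = F y := hF.eq_iff
  rw [rotation_mul_apply hF]
  simp only [rotation, Matrix.add_apply, Matrix.diagonal_apply, Matrix.diagonal_mul,
    basisMap_apply, hF.injective.eq_iff, hswap, hθ, ha, Pi.add_apply, Real.cos_add, Real.sin_add,
    mul_ite, mul_one, mul_zero]
  push_cast
  rcases eq_or_ne x y with rfl | hdiag
  · simp only [if_true, (hfix x).symm, if_false]
    linear_combination Complex.sin (θ x) * Complex.sin (θ' x) * hpp x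
  · simp only [hdiag, if_false]
    split_ifs <;> ring

theorem conjTranspose_rotation {θ : α → ℝ} (hθ : ∀ y, θ (F y) = θ y) :
    (rotation F a p θ)ᴴ = rotation F a p (-θ) := by
  have hfix (x : α) : F x ≠ x := ne_of_apply_ne a (by simp [ha])
  ext x y
  have hswap : y = F x ↔ x = F y := ⟨fun h => by rw [h, hF x], fun h => by rw [h, hF y]⟩
  simp only [rotation, Matrix.conjTranspose_apply, Matrix.add_apply, Matrix.diagonal_apply,
    Matrix.diagonal_mul, basisMap_apply, hswap, Pi.neg_apply, Real.cos_neg, Real.sin_neg,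
    eq_comm (a := y) (b := x)]
  rcases eq_or_ne x (F y) with rfl | hpair
  · simp [hfix, ha, hθ, (hp (a y)).2, -Complex.ofReal_sin, -Complex.ofReal_cos]
  · rcases eq_or_ne x y with rfl | hdiag
    · simp [(hfix x).symm, -Complex.ofReal_cos]
    · simp [hpair, hdiag]

theorem norm_rotation_le {θ : α → ℝ} (hθ : ∀ y, θ (F y) = θ y) : ‖rotation F a p θ‖ ≤ 1 := by
  refine norm_le_one_of_conjTranspose_mul_self ?_
  rw [conjTranspose_rotation hF ha hp hθ, rotation_mul_rotation hF ha hp hθ, neg_add_cancel]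
  exact rotation_zero F a p

end Rotation

section Kraus

variable {R ι κ l m n : Type*} [Fintype R] [DecidableEq R] [Fintype ι] [Fintype κ] [Fintype n]

/-- The adjoint (Heisenberg picture) of the channel with the Kraus operators `K i`, applied to an
observable `O` of the system and a reference system with basis `R`. -/
def krausDual (K : ι → Matrix n m ℂ) (O : Matrix (R × n) (R × n) ℂ) :
    Matrix (R × m) (R × m) ℂ :=
  ∑ i, (amplify R (K i))ᴴ * O * amplify R (K i)

theorem krausDual_comp [Fintype m] (K : ι → Matrix m l ℂ) (K' : κ → Matrix n m ℂ)
    (O : Matrix (R × n) (R × n) ℂ) :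
    krausDual (fun ik : ι × κ => K' ik.2 * K ik.1) O = krausDual K (krausDual K' O) := by
  simp only [krausDual, Fintype.sum_prod_type, amplify_mul, Matrix.conjTranspose_mul,
    Matrix.mul_sum, Matrix.sum_mul, Matrix.mul_assoc]

theorem krausDual_comp_of_injective {e : κ → ι} (he : e.Injective) {K : ι → Matrix n m ℂ}
    (hK : ∀ i ∉ Set.range e, K i = 0) (O : Matrix (R × n) (R × n) ℂ) :
    krausDual (K ∘ e) O = krausDual K O := by
  refine Fintype.sum_of_injective e he _ _ (fun i hi => ?_) fun k => rfl
  rw [hK i hi, amplify, Matrix.kronecker_zero, Matrix.mul_zero]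

end Kraus

section Approximates

variable {ι κ l m n : Type*} [Fintype ι] [Fintype κ] [Fintype l] [DecidableEq l] [Fintype m]
  [DecidableEq m] [Fintype n] [DecidableEq n]

/-- In the Heisenberg picture and in the operator norm, the channel with the Kraus operators `K i`
agrees up to the error `e` with conjugation by `V`, also in the presence of a reference system. -/
def Approximates (K : ι → Matrix n m ℂ) (V : Matrix n m ℂ) (e : ℝ) : Prop :=
  ∀ (r : ℕ) (O : Matrix (Fin r × n) (Fin r × n) ℂ),
    ‖krausDual K O - (amplify (Fin r) V)ᴴ * O * amplify (Fin r) V‖ ≤ e * ‖O‖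

/-- The dual channel with the Kraus operators `K i` does not increase the operator norm, also in the
presence of a reference system. -/
def IsContractive (K : ι → Matrix n m ℂ) : Prop :=
  ∀ (r : ℕ) (O : Matrix (Fin r × n) (Fin r × n) ℂ), ‖krausDual K O‖ ≤ ‖O‖

theorem Approximates.comp {K : ι → Matrix m l ℂ} {V : Matrix m l ℂ} {e : ℝ}
    {K' : κ → Matrix n m ℂ} {V' : Matrix n m ℂ} {e' : ℝ} (h : Approximates K V e)
    (h' : Approximates K' V' e') (hV : ‖V‖ ≤ 1) (he : 0 ≤ e) (hK' : IsContractive K') :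
    Approximates (fun ik : ι × κ => K' ik.2 * K ik.1) (V' * V) (e + e') := by
  intro r O
  set W := amplify (Fin r) V
  set W' := amplify (Fin r) V'
  have hW : ‖W‖ ≤ 1 := (norm_amplify_le V).trans hV
  have hsplit : krausDual K (krausDual K' O) - (W' * W)ᴴ * O * (W' * W) =
      (krausDual K (krausDual K' O) - Wᴴ * krausDual K' O * W) +
        Wᴴ * (krausDual K' O - W'ᴴ * O * W') * W := by
    simp only [Matrix.mul_sub, Matrix.sub_mul, Matrix.conjTranspose_mul, Matrix.mul_assoc]
    abel
  rw [krausDual_comp, amplify_mul, hsplit]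
  calc _ ≤ e * ‖krausDual K' O‖ + ‖krausDual K' O - W'ᴴ * O * W'‖ :=
        (norm_add_le _ _).trans (add_le_add (h r _) (norm_conjTranspose_mul_mul_le hW _))
    _ ≤ e * ‖O‖ + e' * ‖O‖ := add_le_add (mul_le_mul_of_nonneg_left (hK' r O) he) (h' r O)
    _ = (e + e') * ‖O‖ := (add_mul _ _ _).symm

theorem Approximates.mono {K : ι → Matrix n m ℂ} {V : Matrix n m ℂ} {e e' : ℝ}
    (h : Approximates K V e) (he : e ≤ e') : Approximates K V e' := fun r O =>
  (h r O).trans (mul_le_mul_of_nonneg_right he (norm_nonneg _))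

theorem Approximates.of_norm_le_one {K : ι → Matrix n m ℂ} {V W : Matrix n m ℂ} {e : ℝ}
    (h : Approximates K V e) (hV : ‖V‖ ≤ 1) (hW : ‖W‖ ≤ 1) : Approximates K W (e + 2) := by
  intro r O
  have hconj {X : Matrix n m ℂ} (hX : ‖X‖ ≤ 1) :
      ‖(amplify (Fin r) X)ᴴ * O * amplify (Fin r) X‖ ≤ ‖O‖ :=
    norm_conjTranspose_mul_mul_le ((norm_amplify_le X).trans hX) O
  calc _ ≤ e * ‖O‖ + (‖O‖ + ‖O‖) :=
        (norm_sub_le_norm_sub_add_norm_sub _ _ _).trans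
          (add_le_add (h r O) (norm_sub_le_of_le (hconj hV) (hconj hW)))
    _ = (e + 2) * ‖O‖ := by ring

end Approximates

section Dilation

variable {R κ m n : Type*}

/-- The observable `O ⊗ 1` of a system that is extended by an ancilla with basis `κ`. -/
def extendObservable (κ : Type*) [DecidableEq κ] (O : Matrix (R × n) (R × n) ℂ) :
    Matrix (R × (n × κ)) (R × (n × κ)) ℂ :=
  (amplify κ O).submatrix (fun x => (x.2.2, (x.1, x.2.1))) fun x => (x.2.2, (x.1, x.2.1))

theorem conjTranspose_extendObservable [DecidableEq κ] (O : Matrix (R × n) (R × n) ℂ) :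
    (extendObservable κ O)ᴴ = extendObservable κ Oᴴ := by
  rw [extendObservable, extendObservable, Matrix.conjTranspose_submatrix, amplify_conjTranspose]

variable [Fintype R] [DecidableEq R] [Fintype κ] [DecidableEq κ] [Fintype n]

theorem krausDual_rows (V : Matrix (n × κ) m ℂ) (O : Matrix (R × n) (R × n) ℂ) :
    krausDual (fun k => V.submatrix (·, k) id) O =
      (amplify R V)ᴴ * extendObservable κ O * amplify R V := by
  ext x y
  simp only [krausDual, Matrix.sum_apply, Matrix.mul_apply, extendObservable, amplify_apply,
    Matrix.conjTranspose_apply, Matrix.submatrix_apply, Fintype.sum_prod_type, id,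
    apply_ite star, star_zero, ite_mul, mul_ite, zero_mul, mul_zero, Finset.mem_univ, if_true,
    Finset.sum_ite_irrel, Finset.sum_const_zero, Finset.sum_ite_eq', Finset.sum_mul]
  rw [Finset.sum_comm]

variable [DecidableEq n]

theorem norm_extendObservable_le (O : Matrix (R × n) (R × n) ℂ) : ‖extendObservable κ O‖ ≤ ‖O‖ :=
  (norm_submatrix_le (fun x y h => by grind) _).trans (norm_amplify_le O)

omit [DecidableEq κ] in
theorem isContractive_rows [Fintype m] [DecidableEq m] {V : Matrix (n × κ) m ℂ} (hV : ‖V‖ ≤ 1) :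
    IsContractive fun k => V.submatrix (·, k) id := by
  classical
  intro r O
  rw [krausDual_rows]
  exact (norm_conjTranspose_mul_mul_le ((norm_amplify_le V).trans hV) _).trans
    (norm_extendObservable_le O)

/-- The operator that adjoins to a system with basis `n` an ancilla with the state vector `v`. -/
def adjoin (n : Type*) [DecidableEq n] {κ : Type*} (v : κ → ℂ) : Matrix (n × κ) n ℂ :=
  Matrix.of fun x y => if x.1 = y then v x.2 else 0

theorem extendObservable_mul_adjoin (v : κ → ℂ) (O : Matrix (R × n) (R × n) ℂ) :
    extendObservable κ O * amplify R (adjoin n v) = amplify R (adjoin n v) * O := by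
  ext x y
  simp [Matrix.mul_apply, extendObservable, amplify_apply, adjoin, Fintype.sum_prod_type, mul_comm]

theorem conjTranspose_adjoin_mul_extendObservable (v : κ → ℂ) (O : Matrix (R × n) (R × n) ℂ) :
    (amplify R (adjoin n v))ᴴ * extendObservable κ O = O * (amplify R (adjoin n v))ᴴ := by
  have h := congrArg Matrix.conjTranspose (extendObservable_mul_adjoin v Oᴴ)
  rwa [Matrix.conjTranspose_mul, Matrix.conjTranspose_mul, conjTranspose_extendObservable,
    Matrix.conjTranspose_conjTranspose] at h

omit [DecidableEq κ] in
theorem conjTranspose_adjoin_mul_mul_adjoin_apply (v : κ → ℂ) (X : Matrix (n × κ) (n × κ) ℂ)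
    (x y : n) :
    ((adjoin n v)ᴴ * X * adjoin n v) x y = ∑ k, ∑ k', star (v k) * X (x, k) (y, k') * v k' := by
  rw [Finset.sum_comm]
  simp [Matrix.mul_apply, adjoin, Fintype.sum_prod_type, Finset.sum_mul, apply_ite (starRingEnd ℂ)]

omit [DecidableEq κ] in
theorem conjTranspose_adjoin_mul_self {v : κ → ℂ} (hv : ∑ k, ‖v k‖ ^ 2 = 1) :
    (adjoin n v)ᴴ * adjoin n v = 1 := by
  classical
  have hsum : ∑ k, (‖v k‖ : ℂ) ^ 2 = 1 := mod_cast hv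
  ext x y
  rw [← Matrix.mul_one (adjoin n v)ᴴ, conjTranspose_adjoin_mul_mul_adjoin_apply]
  rcases eq_or_ne x y with rfl | hxy
  · simp [Matrix.one_apply, Complex.conj_mul', hsum]
  · simp [hxy]

end Dilation

section OnWires

variable {W W' : Type}

theorem forall_iff_of_range (f : W ↪ W') {P : W' → Prop} :
    (∀ w, P w) ↔ (∀ w ∉ Set.range f, P w) ∧ ∀ v, P (f v) :=
  ⟨fun h => ⟨fun w _ => h w, fun v => h (f v)⟩, fun h w =>
    (em (w ∈ Set.range f)).elim (fun ⟨v, hv⟩ => hv ▸ h.2 v) (h.1 w)⟩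

open Classical in
/-- A basis state of the qubits `W'` consists of one of the qubits that are selected by `f` and one
of the other qubits. -/
noncomputable def splitWires (f : W ↪ W') :
    (W' → Bool) ≃ (W → Bool) × ({w // w ∉ Set.range f} → Bool) :=
  (Equiv.piEquivPiSubtypeProd (· ∈ Set.range f) fun _ => Bool).trans
    (((Equiv.ofInjective f f.injective).symm.arrowCongr (Equiv.refl _)).prodCongr (Equiv.refl _))

variable [Fintype W] [Fintype W'] [DecidableEq W']

/-- The operator `X`, applied to the qubits that are selected by the embedding `f`. -/
noncomputable def onWires (f : W ↪ W') (X : Matrix (W → Bool) (W → Bool) ℂ) :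
    Matrix (W' → Bool) (W' → Bool) ℂ :=
  (X ⊗ₖ (1 : Matrix ({w // w ∉ Set.range f} → Bool) _ ℂ)).submatrix (splitWires f) (splitWires f)

theorem onWires_apply (f : W ↪ W') (X : Matrix (W → Bool) (W → Bool) ℂ)
    (x y : W' → Bool) :
    onWires f X x y = if ∀ w ∉ Set.range f, x w = y w then X (x ∘ f) (y ∘ f) else 0 := by
  have h (x : W' → Bool) : splitWires f x = (x ∘ f, fun w => x w.1) := rfl
  simp [onWires, h, Matrix.one_apply, funext_iff]

theorem onWires_one (f : W ↪ W') : onWires f 1 = 1 := by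
  ext x y
  simp [onWires_apply, Matrix.one_apply, funext_iff, ← ite_and,
    forall_iff_of_range f (P := fun w => x w = y w)]

theorem onWires_mul [DecidableEq W] (f : W ↪ W')
    (X Y : Matrix (W → Bool) (W → Bool) ℂ) :
    onWires f (X * Y) = onWires f X * onWires f Y := by
  rw [onWires, onWires, onWires, Matrix.submatrix_mul_equiv, ← Matrix.mul_kronecker_mul,
    Matrix.one_mul]

end OnWires

section GateMap

variable {Q N b : ℕ} {W W' : Type}

/-- The gate `g`, applied to the qubits that are selected by the embedding `f`. -/
def Gate.map (f : W ↪ W') : Gate Q N b W → Gate Q N b W'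
  | .elementary s hs t ht U => .elementary (s.map f) (by simpa using hs) (f t) (by simpa using ht) U
  | .oracle p => .oracle (p.trans f)

theorem Gate.time_map (τ : ℕ) (f : W ↪ W') (g : Gate Q N b W) : (g.map f).time τ = g.time τ := by
  cases g <;> rfl

variable [Fintype W] [DecidableEq W] [Fintype W'] [DecidableEq W']

theorem Gate.toMatrix_map (Z : Table Q N b) (f : W ↪ W') (g : Gate Q N b W) :
    (g.map f).toMatrix Z = onWires f (g.toMatrix Z) := by
  ext x y
  rw [onWires_apply]
  cases g with
  | elementary s hs t ht U =>
    have hne (w : W') (hw : w ∉ Set.range f) : w ≠ f t := fun h => hw ⟨t, h.symm⟩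
    simp only [Gate.map, Gate.toMatrix, Matrix.of_apply, Finset.forall_mem_map, funext_iff,
      forall_iff_of_range f (P := fun w => w ≠ f t → x w = y w),
      forall_iff_of_range f (P := fun w => x w = y w), f.injective.ne_iff, Function.comp_apply]
    grind
  | oracle p =>
    have h (o : OracleWire Q N b) (w : W') (hw : w ∉ Set.range f) : w ≠ f (p o) :=
      fun e => hw ⟨p o, e.symm⟩
    simp only [Gate.map, Gate.toMatrix, Matrix.of_apply, Function.Embedding.trans_apply,
      forall_iff_of_range f (P := fun w => (∀ i, w ≠ f (p (.re i))) → (∀ i, w ≠ f (p (.im i))) →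
        x w = y w), f.injective.ne_iff, Function.comp_apply]
    grind

theorem listMatrix_append (Z : Table Q N b) (l₁ l₂ : List (Gate Q N b W)) :
    listMatrix Z (l₁ ++ l₂) = listMatrix Z l₂ * listMatrix Z l₁ := by
  induction l₁ with
  | nil => simp [listMatrix]
  | cons g l ih => simp [listMatrix, ih, Matrix.mul_assoc]

theorem listMatrix_map (Z : Table Q N b) (f : W ↪ W') (l : List (Gate Q N b W)) :
    listMatrix Z (l.map (Gate.map f)) = onWires f (listMatrix Z l) := by
  induction l with
  | nil => exact (onWires_one f).symm
  | cons g l ih => rw [List.map_cons, listMatrix, listMatrix, ih, Gate.toMatrix_map, onWires_mul]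

end GateMap

section KrausOp

variable {Q N b : ℕ} {S A : Type}

/-- The Kraus operator of a unitary on system and ancilla qubits, for ancillas that start in
`|0⋯0⟩` and end in the basis state `z`. -/
def krausOp (L : Matrix (S ⊕ A → Bool) (S ⊕ A → Bool) ℂ) (z : A → Bool) :
    Matrix (S → Bool) (S → Bool) ℂ :=
  L.submatrix (fun x => Sum.elim x z) fun y => Sum.elim y fun _ => false

/-- The first ancillas of a circuit with ancillas of two kinds, together with the system. -/
def leftWires (S : Type) (a₁ a₂ : ℕ) : S ⊕ Fin a₁ ↪ S ⊕ Fin (a₁ + a₂) :=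
  (Function.Embedding.refl S).sumMap (Fin.castAddEmb a₂)

/-- The last ancillas of a circuit with ancillas of two kinds, together with the system. -/
def rightWires (S : Type) (a₁ a₂ : ℕ) : S ⊕ Fin a₂ ↪ S ⊕ Fin (a₁ + a₂) :=
  (Function.Embedding.refl S).sumMap (Fin.natAddEmb a₁)

variable [Fintype S] [DecidableEq S] {a₁ a₂ : ℕ}

theorem onWires_leftWires_apply (L : Matrix (S ⊕ Fin a₁ → Bool) (S ⊕ Fin a₁ → Bool) ℂ)
    (x y : S → Bool) (z₁ w₁ : Fin a₁ → Bool) (z₂ w₂ : Fin a₂ → Bool) :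
    onWires (leftWires S a₁ a₂) L (Sum.elim x (Fin.append z₁ z₂)) (Sum.elim y (Fin.append w₁ w₂)) =
      if z₂ = w₂ then L (Sum.elim x z₁) (Sum.elim y w₁) else 0 := by
  have hcomp (x : S → Bool) (z₁ : Fin a₁ → Bool) (z₂ : Fin a₂ → Bool) :
      Sum.elim x (Fin.append z₁ z₂) ∘ leftWires S a₁ a₂ = Sum.elim x z₁ := by
    ext (i | i) <;> simp [leftWires]
  rw [onWires_apply, hcomp, hcomp]
  congr 1
  simp [leftWires, funext_iff, Fin.forall_fin_add, Fin.ext_iff]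
  grind

theorem onWires_rightWires_apply (L : Matrix (S ⊕ Fin a₂ → Bool) (S ⊕ Fin a₂ → Bool) ℂ)
    (x y : S → Bool) (z₁ w₁ : Fin a₁ → Bool) (z₂ w₂ : Fin a₂ → Bool) :
    onWires (rightWires S a₁ a₂) L (Sum.elim x (Fin.append z₁ z₂)) (Sum.elim y (Fin.append w₁ w₂)) =
      if z₁ = w₁ then L (Sum.elim x z₂) (Sum.elim y w₂) else 0 := by
  have hcomp (x : S → Bool) (z₁ : Fin a₁ → Bool) (z₂ : Fin a₂ → Bool) :
      Sum.elim x (Fin.append z₁ z₂) ∘ rightWires S a₁ a₂ = Sum.elim x z₂ := by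
    ext (i | i) <;> simp [rightWires]
  rw [onWires_apply, hcomp, hcomp]
  congr 1
  simp [rightWires, funext_iff, Fin.forall_fin_add, Fin.ext_iff]
  grind

theorem krausOp_onWires_mul_onWires (L₁ : Matrix (S ⊕ Fin a₁ → Bool) (S ⊕ Fin a₁ → Bool) ℂ)
    (L₂ : Matrix (S ⊕ Fin a₂ → Bool) (S ⊕ Fin a₂ → Bool) ℂ) (z₁ : Fin a₁ → Bool)
    (z₂ : Fin a₂ → Bool) :
    krausOp (onWires (rightWires S a₁ a₂) L₂ * onWires (leftWires S a₁ a₂) L₁)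
      (Fin.append z₁ z₂) = krausOp L₂ z₂ * krausOp L₁ z₁ := by
  let e : (S → Bool) × (Fin a₁ → Bool) × (Fin a₂ → Bool) ≃ (S ⊕ Fin (a₁ + a₂) → Bool) :=
    ((Equiv.refl _).prodCongr (Fin.appendEquiv a₁ a₂)).trans
      (Equiv.sumArrowEquivProdArrow _ _ _).symm
  have he (p) : e p = Sum.elim p.1 (Fin.append p.2.1 p.2.2) := rfl
  have hzero : (fun _ : Fin (a₁ + a₂) => false) = Fin.append (fun _ => false) fun _ => false := by
    ext i
    induction i using Fin.addCases <;> simp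
  ext x y
  simp only [krausOp, Matrix.submatrix_apply, Matrix.mul_apply, hzero, ← e.sum_comp, he,
    onWires_leftWires_apply, onWires_rightWires_apply, Fintype.sum_prod_type]
  simp

end KrausOp

section Circuit

variable {Q N b : ℕ}

/-- The circuit without gates and ancillas. -/
def Circuit.empty : Circuit Q N b := ⟨0, []⟩

/-- The circuit `c₁`, followed by the circuit `c₂` with fresh ancillas. -/
def Circuit.comp (c₁ c₂ : Circuit Q N b) : Circuit Q N b where
  ancillas := c₁.ancillas + c₂.ancillas
  gates := c₁.gates.map (Gate.map (leftWires _ c₁.ancillas c₂.ancillas)) ++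
    c₂.gates.map (Gate.map (rightWires _ c₁.ancillas c₂.ancillas))

/-- The `n`-fold repetition of a circuit, each time with fresh ancillas. -/
def Circuit.iterate (c : Circuit Q N b) : ℕ → Circuit Q N b
  | 0 => Circuit.empty
  | n + 1 => (c.iterate n).comp c

theorem Circuit.time_comp (τ : ℕ) (c₁ c₂ : Circuit Q N b) :
    (c₁.comp c₂).time τ = c₁.time τ + c₂.time τ := by
  have h {W W' : Type} (f : W ↪ W') (l : List (Gate Q N b W)) :
      (l.map (Gate.map f)).map (Gate.time τ) = l.map (Gate.time τ) := by
    simp [Gate.time_map]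
  rw [time, time, time, comp, List.map_append, List.sum_append, h, h]
  exact add_add_add_comm _ _ _ _

theorem Circuit.time_iterate (τ : ℕ) (c : Circuit Q N b) (n : ℕ) :
    (c.iterate n).time τ = n * c.time τ := by
  induction n with
  | zero => simp [Circuit.iterate, Circuit.empty, Circuit.time]
  | succ n ih => rw [Circuit.iterate, Circuit.time_comp, ih, Nat.succ_mul]

/-- The Kraus operators of the channel that a circuit realizes on the system qubits. -/
noncomputable def Circuit.kraus (c : Circuit Q N b) (Z : Table Q N b) :
    (Fin c.ancillas → Bool) → Matrix (SysWire Q N → Bool) (SysWire Q N → Bool) ℂ :=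
  krausOp (listMatrix Z c.gates)

theorem Circuit.kraus_comp (c₁ c₂ : Circuit Q N b) (Z : Table Q N b)
    (z : (Fin c₁.ancillas → Bool) × (Fin c₂.ancillas → Bool)) :
    (c₁.comp c₂).kraus Z (Fin.append z.1 z.2) = c₂.kraus Z z.2 * c₁.kraus Z z.1 := by
  have h := krausOp_onWires_mul_onWires (listMatrix Z c₁.gates) (listMatrix Z c₂.gates) z.1 z.2
  rwa [← listMatrix_map, ← listMatrix_map, ← listMatrix_append] at h

theorem Circuit.krausDual_comp (c₁ c₂ : Circuit Q N b) (Z : Table Q N b) {R : Type*} [Fintype R]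
    [DecidableEq R]
    (O : Matrix (R × (SysWire Q N → Bool)) (R × (SysWire Q N → Bool)) ℂ) :
    krausDual ((c₁.comp c₂).kraus Z) O =
      krausDual (fun z : (Fin c₁.ancillas → Bool) × (Fin c₂.ancillas → Bool) =>
        c₂.kraus Z z.2 * c₁.kraus Z z.1) O := by
  simp only [← Circuit.kraus_comp]
  exact ((Fin.appendEquiv c₁.ancillas c₂.ancillas).sum_comp _).symm

theorem Circuit.approximates_empty (Z : Table Q N b) :
    Approximates ((Circuit.empty : Circuit Q N b).kraus Z) 1 0 := by
  intro r O
  have : Unique (Fin (Circuit.empty : Circuit Q N b).ancillas → Bool) :=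
    inferInstanceAs (Unique (Fin 0 → Bool))
  have hK (z) : (Circuit.empty : Circuit Q N b).kraus Z z = 1 := by
    obtain rfl : z = fun _ => false := Subsingleton.elim _ _
    ext x y
    simp [kraus, krausOp, empty, listMatrix, Matrix.one_apply, funext_iff]
  rw [krausDual, Fintype.sum_unique, hK]
  simp [amplify_one]

theorem Circuit.approximates_iterate {c : Circuit Q N b} {Z : Table Q N b}
    {V : Matrix (SysWire Q N → Bool) (SysWire Q N → Bool) ℂ} {e : ℝ}
    (h : Approximates (c.kraus Z) V e) (hV : ‖V‖ ≤ 1) (he : 0 ≤ e)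
    (hc : IsContractive (c.kraus Z)) (n : ℕ) :
    Approximates ((c.iterate n).kraus Z) (V ^ n) (n * e) := by
  induction n with
  | zero =>
    rw [pow_zero, Nat.cast_zero, zero_mul]
    exact Circuit.approximates_empty Z
  | succ n ih =>
    intro r O
    rw [iterate, Circuit.krausDual_comp, pow_succ', Nat.cast_succ, add_one_mul]
    exact ih.comp h (norm_pow_le_one hV n) (by positivity) hc r O

end Circuit

section Duality

variable {Q N b r : ℕ}

theorem ofBits_label {n j : ℕ} (h : j < n) : Nat.ofBits (label (width n) j) = j := by
  unfold label
  rw [Nat.ofBits_testBit]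
  exact Nat.mod_eq_of_lt (h.trans_le (Nat.le_pow_clog one_lt_two n))

theorem sysLabel_injective : (sysLabel : Fin Q × Fin N → SysWire Q N → Bool).Injective := by
  rintro ⟨q, j⟩ ⟨q', j'⟩ h
  obtain ⟨hq, hj⟩ := Sum.elim_eq_iff.1 h
  have hq := congrArg Nat.ofBits hq
  have hj := congrArg Nat.ofBits hj
  rw [ofBits_label q.2, ofBits_label q'.2] at hq
  rw [ofBits_label j.2, ofBits_label j'.2] at hj
  exact Prod.ext (Fin.ext hq) (Fin.ext hj)

/-- The isometry that encodes `ℂ^Q ⊗ ℂ^N` in the system qubits. -/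
def encodeMatrix (Q N : ℕ) : Matrix (SysWire Q N → Bool) (Fin Q × Fin N) ℂ := basisMap sysLabel

/-- The isometry that adjoins to the qubits `S` the ancilla qubits `A` in the state `|0⋯0⟩`. -/
def zeroAncillas (S A : Type) [Fintype S] [Fintype A] : Matrix (S ⊕ A → Bool) (S → Bool) ℂ :=
  basisMap fun x => Sum.elim x fun _ => false

theorem encode_eq (σ : Matrix (Fin r × (Fin Q × Fin N)) (Fin r × (Fin Q × Fin N)) ℂ) :
    encode σ = amplify (Fin r) (encodeMatrix Q N) * σ * (amplify (Fin r) (encodeMatrix Q N))ᴴ :=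
  rfl

theorem trace_encode (σ : Matrix (Fin r × (Fin Q × Fin N)) (Fin r × (Fin Q × Fin N)) ℂ) :
    (encode σ).trace = σ.trace := by
  rw [encode_eq, Matrix.mul_assoc, Matrix.trace_mul_comm, Matrix.mul_assoc, ← amplify_conjTranspose,
    ← amplify_mul, encodeMatrix, conjTranspose_basisMap_mul_self sysLabel_injective, amplify_one,
    mul_one]

theorem encode_conj {U : Matrix (Fin Q × Fin N) (Fin Q × Fin N) ℂ}
    {V : Matrix (SysWire Q N → Bool) (SysWire Q N → Bool) ℂ}
    (hV : V * encodeMatrix Q N = encodeMatrix Q N * U)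
    (σ : Matrix (Fin r × (Fin Q × Fin N)) (Fin r × (Fin Q × Fin N)) ℂ) :
    encode (amplify (Fin r) U * σ * (amplify (Fin r) U)ᴴ) =
      amplify (Fin r) V * encode σ * (amplify (Fin r) V)ᴴ := by
  have h : amplify (Fin r) V * amplify (Fin r) (encodeMatrix Q N) =
      amplify (Fin r) (encodeMatrix Q N) * amplify (Fin r) U := by
    rw [← amplify_mul, ← amplify_mul, hV]
  have h' := congrArg Matrix.conjTranspose h
  rw [Matrix.conjTranspose_mul, Matrix.conjTranspose_mul] at h'
  simp only [encode_eq, Matrix.mul_assoc, h']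
  rw [← Matrix.mul_assoc, ← h, Matrix.mul_assoc]

theorem adjoinZeros_eq {a : ℕ} {S : Type} [Fintype S] [DecidableEq S]
    (ω : Matrix (Fin r × (S → Bool)) (Fin r × (S → Bool)) ℂ) :
    adjoinZeros ω = amplify (Fin r) (zeroAncillas S (Fin a)) * ω *
      (amplify (Fin r) (zeroAncillas S (Fin a)))ᴴ := by
  have h (x : S ⊕ Fin a → Bool) (y : S → Bool) : x = Sum.elim y (fun _ => false) ↔
      (fun w => x (.inl w)) = y ∧ ∀ i, x (.inr i) = false := by
    simp [funext_iff, Sum.forall]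
  ext ⟨i, x⟩ ⟨j, y⟩
  simp only [adjoinZeros, Matrix.of_apply, Matrix.mul_apply, Matrix.conjTranspose_apply,
    amplify_apply, zeroAncillas, basisMap_apply, h, Fintype.sum_prod_type]
  by_cases hx : ∀ i, x (.inr i) = false <;> by_cases hy : ∀ i, y (.inr i) = false <;>
    simp [hx, hy, apply_ite (starRingEnd ℂ)]

theorem Circuit.output_eq_sum (c : Circuit Q N b) (Z : Table Q N b)
    (σ : Matrix (Fin r × (Fin Q × Fin N)) (Fin r × (Fin Q × Fin N)) ℂ) :
    c.output Z σ =
      ∑ z, amplify (Fin r) (c.kraus Z z) * encode σ * (amplify (Fin r) (c.kraus Z z))ᴴ := by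
  set J := zeroAncillas (SysWire Q N) (Fin c.ancillas)
  set L := listMatrix Z c.gates
  have hK (z) : amplify (Fin r) (c.kraus Z z) =
      (amplify (Fin r) L * amplify (Fin r) J).submatrix (fun x => (x.1, Sum.elim x.2 z)) id := by
    ext x y
    rw [← amplify_mul, Matrix.submatrix_apply, amplify_apply, amplify_apply]
    simp only [J, zeroAncillas, mul_basisMap_apply]
    rfl
  have hout : c.output Z σ = traceAncillas ((amplify (Fin r) L * amplify (Fin r) J) * encode σ *
      (amplify (Fin r) L * amplify (Fin r) J)ᴴ) := by
    rw [Matrix.conjTranspose_mul, output, adjoinZeros_eq]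
    simp only [Matrix.mul_assoc]
    rfl
  rw [hout]
  ext x y
  simp only [traceAncillas, Matrix.of_apply, Matrix.sum_apply, hK, Matrix.mul_apply,
    Matrix.submatrix_apply, Matrix.conjTranspose_apply, id]

theorem Circuit.trace_output_sub_mul (c : Circuit Q N b) (Z : Table Q N b)
    (V : Matrix (SysWire Q N → Bool) (SysWire Q N → Bool) ℂ)
    (σ : Matrix (Fin r × (Fin Q × Fin N)) (Fin r × (Fin Q × Fin N)) ℂ)
    (O : Matrix (Fin r × (SysWire Q N → Bool)) (Fin r × (SysWire Q N → Bool)) ℂ) :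
    ((c.output Z σ - amplify (Fin r) V * encode σ * (amplify (Fin r) V)ᴴ) * O).trace =
      ((krausDual (c.kraus Z) O - (amplify (Fin r) V)ᴴ * O * amplify (Fin r) V) *
        encode σ).trace := by
  have h (K : Matrix (Fin r × (SysWire Q N → Bool)) (Fin r × (SysWire Q N → Bool)) ℂ) :
      (K * encode σ * Kᴴ * O).trace = (Kᴴ * O * K * encode σ).trace := by
    rw [Matrix.mul_assoc _ Kᴴ, Matrix.trace_mul_comm, ← Matrix.mul_assoc]
  rw [output_eq_sum, Matrix.sub_mul, Matrix.sub_mul, Matrix.trace_sub, Matrix.trace_sub, h,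
    krausDual, Matrix.sum_mul, Matrix.sum_mul, Matrix.trace_sum, Matrix.trace_sum]
  simp only [h]

open scoped ComplexOrder in
/-- The operator norm is dual to the trace norm, in which a density matrix has norm one; so the
error on the output is at most that in the Heisenberg picture. -/
theorem Approximates.simulates {c : Circuit Q N b} {Z : Table Q N b} {ε : ℝ} (hε : 0 ≤ ε)
    {U : Matrix (Fin Q × Fin N) (Fin Q × Fin N) ℂ}
    {V : Matrix (SysWire Q N → Bool) (SysWire Q N → Bool) ℂ}
    (hV : V * encodeMatrix Q N = encodeMatrix Q N * U) (h : Approximates (c.kraus Z) V ε) :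
    c.Simulates Z U ε := by
  intro r σ hσ htr
  refine (congrArg (fun ω => ‖c.output Z σ - ω‖) (encode_conj hV σ)).trans_le ?_
  refine norm_le_of_norm_trace_mul_le hε fun O => ?_
  rw [Circuit.trace_output_sub_mul]
  exact (norm_trace_mul_le_of_posSemidef _ (hσ.mul_mul_conjTranspose_same _)
    ((trace_encode σ).trans htr)).trans (h r O)

end Duality

section Gates

variable {Q N b : ℕ} {W : Type} [DecidableEq W]

/-- Flip the qubit `t` of a basis state. -/
def flipQubit (t : W) (y : W → Bool) : W → Bool := Function.update y t (!y t)

theorem flipQubit_involutive (t : W) : (flipQubit t).Involutive := fun y => by simp [flipQubit]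

/-- The Pauli matrix `X`. -/
def notUnitary : Matrix.unitaryGroup Bool ℂ :=
  ⟨basisMap not, Matrix.mem_unitaryGroup_iff'.2
    (conjTranspose_basisMap_mul_self Bool.involutive_not.injective)⟩

/-- The rotation by the angle `2 θ` about the axis `p`. -/
noncomputable def rotationUnitary {p : Bool → ℂ} (hp : IsAxis p) (θ : ℝ) :
    Matrix.unitaryGroup Bool ℂ :=
  ⟨rotation not id p fun _ => θ, Matrix.mem_unitaryGroup_iff'.2 <| by
    rw [Matrix.star_eq_conjTranspose,
      conjTranspose_rotation Bool.involutive_not (a := id) (fun _ => rfl) hp fun _ => rfl,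
      rotation_mul_rotation Bool.involutive_not (a := id) (fun _ => rfl) hp fun _ => rfl,
      neg_add_cancel]
    exact rotation_zero not id p⟩

/-- The Hadamard gate. -/
noncomputable def hadamardUnitary : Matrix.unitaryGroup Bool ℂ :=
  ⟨((√2)⁻¹ : ℂ) • Matrix.of fun a c => if a && c then -1 else 1, by
    have h : ((√2 : ℝ) : ℂ) ^ 2 = 2 := mod_cast Real.sq_sqrt zero_le_two
    rw [Matrix.mem_unitaryGroup_iff]
    ext a c
    cases a <;> cases c <;> simp [Matrix.mul_apply, Matrix.star_apply] <;> grind⟩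

variable [Fintype W]

theorem toMatrix_elementary_apply (Z : Table Q N b) {s : Finset W} (hs : s.card ≤ 2) {t : W}
    (ht : t ∉ s) (U : Matrix.unitaryGroup Bool ℂ) (x y : W → Bool) :
    (Gate.elementary s hs t ht U : Gate Q N b W).toMatrix Z x y =
      if ∀ i, i ≠ t → x i = y i then
        if ∀ i ∈ s, y i = true then (U : Matrix Bool Bool ℂ) (x t) (y t)
        else if x t = y t then 1 else 0
      else 0 := by
  simp only [Gate.toMatrix, Matrix.of_apply, funext_iff]
  grind

theorem toMatrix_not (Z : Table Q N b) {s : Finset W} (hs : s.card ≤ 2) {t : W} (ht : t ∉ s) :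
    (Gate.elementary s hs t ht notUnitary : Gate Q N b W).toMatrix Z =
      basisMap fun y => if ∀ i ∈ s, y i = true then flipQubit t y else y := by
  ext x y
  simp only [toMatrix_elementary_apply, basisMap_apply, funext_iff, notUnitary, flipQubit]
  grind

theorem listMatrix_map_not (Z : Table Q N b) {ι : Type*} {s : ι → Finset W}
    (hs : ∀ i, (s i).card ≤ 2) {t : ι → W} (ht : ∀ i j, t i ∉ s j) (hinj : t.Injective)
    {l : List ι} (hl : l.Nodup) :
    listMatrix Z (l.map fun i =>
      (Gate.elementary (s i) (hs i) (t i) (ht i i) notUnitary : Gate Q N b W)) =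
      basisMap fun y w => y w ^^ decide (∃ i ∈ l, w = t i ∧ ∀ v ∈ s i, y v = true) := by
  induction l with
  | nil => simp [listMatrix, ← basisMap_id, Function.id_def]
  | cons i l ih =>
    rw [List.nodup_cons] at hl
    have hcontrol (y : W → Bool) (j : ι) (v : W) (hv : v ∈ s j) : flipQubit (t i) y v = y v :=
      Function.update_of_ne (fun e : v = t i => ht i j (e ▸ hv)) _ _
    have hnotMem (j : ι) (hj : j ∈ l) : t i ≠ t j := fun e => hl.1 (hinj e ▸ hj)
    rw [List.map_cons, listMatrix, ih hl.2, toMatrix_not, basisMap_mul_basisMap]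
    congr 1
    funext y w
    simp only [Function.comp_apply, flipQubit] at hcontrol ⊢
    grind

theorem toMatrix_rotation (Z : Table Q N b) {p : Bool → ℂ} (hp : IsAxis p) (θ : ℝ) {v t : W}
    (hs : ({v} : Finset W).card ≤ 2) (ht : t ∉ ({v} : Finset W)) :
    (Gate.elementary {v} hs t ht (rotationUnitary hp θ) : Gate Q N b W).toMatrix Z =
      rotation (flipQubit t) (fun y => y t) p fun y => if y v = true then θ else 0 := by
  have hvt : v ≠ t := fun e => ht (Finset.mem_singleton.2 e.symm)
  ext x y
  have hflip : x = flipQubit t y ↔ (∀ i, i ≠ t → x i = y i) ∧ x t = !y t := by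
    rw [flipQubit, Function.eq_update_iff, and_comm]
  have heq : x = y ↔ (∀ i, i ≠ t → x i = y i) ∧ x t = y t := by
    rw [funext_iff]
    grind
  rw [toMatrix_elementary_apply]
  simp only [rotationUnitary, rotation, Matrix.add_apply, Matrix.diagonal_mul,
    Matrix.diagonal_apply, basisMap_apply, hflip, heq, Finset.mem_singleton, forall_eq, id]
  by_cases h : ∀ i, i ≠ t → x i = y i
  · rw [h v hvt]
    by_cases hv : y v = true <;> simp [hv] <;> grind
  · simp [h]

theorem listMatrix_map_rotation (Z : Table Q N b) {p : Bool → ℂ} (hp : IsAxis p) {ι : Type*}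
    (θ : ι → ℝ) {v : ι → W} {t : W} (hs : ∀ i, ({v i} : Finset W).card ≤ 2)
    (ht : ∀ i, t ∉ ({v i} : Finset W)) (l : List ι) :
    listMatrix Z (l.map fun i =>
      (Gate.elementary {v i} (hs i) t (ht i) (rotationUnitary hp (θ i)) : Gate Q N b W)) =
      rotation (flipQubit t) (fun y => y t) p
        fun y => (l.map fun i => if y (v i) = true then θ i else 0).sum := by
  induction l with
  | nil => simp [listMatrix, rotation_zero]
  | cons i l ih =>
    have hvt : v i ≠ t := fun e => ht i (Finset.mem_singleton.2 e.symm)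
    rw [List.map_cons, listMatrix, ih, toMatrix_rotation, rotation_mul_rotation
      (flipQubit_involutive t) (fun y => by simp [flipQubit]) hp fun y => by simp [flipQubit, hvt]]
    congr 1
    funext y
    simp [add_comm]

theorem mul_toMatrix_elementary_apply (Z : Table Q N b) {ι : Type*} (X : Matrix ι (W → Bool) ℂ)
    (hs : (∅ : Finset W).card ≤ 2) {t : W} (ht : t ∉ (∅ : Finset W))
    (U : Matrix.unitaryGroup Bool ℂ) (i : ι) (y : W → Bool) :
    (X * (Gate.elementary ∅ hs t ht U : Gate Q N b W).toMatrix Z) i y =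
      ∑ a, X i (Function.update y t a) * (U : Matrix Bool Bool ℂ) a (y t) := by
  rw [Matrix.mul_apply]
  refine (Fintype.sum_of_injective _ (Function.update_injective y t) _ _ (fun u hu => ?_)
    fun a => ?_).symm
  · have : ¬∀ i, i ≠ t → u i = y i := fun h =>
      hu ⟨u t, (Function.eq_update_iff.2 ⟨rfl, h⟩).symm⟩
    rw [toMatrix_elementary_apply, if_neg this, mul_zero]
  · rw [toMatrix_elementary_apply]
    simp +contextual

theorem listMatrix_map_hadamard_apply (Z : Table Q N b) {ι : Type*} {t : ι → W}
    (hs : (∅ : Finset W).card ≤ 2) (ht : ∀ i, t i ∉ (∅ : Finset W)) (hinj : t.Injective)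
    {l : List ι} (hl : l.Nodup) (x : W → Bool) {y : W → Bool} (hy : ∀ i ∈ l, y (t i) = false) :
    listMatrix Z (l.map fun i =>
      (Gate.elementary ∅ hs (t i) (ht i) hadamardUnitary : Gate Q N b W)) x y =
      if ∀ w, (∀ i ∈ l, w ≠ t i) → x w = y w then ((√2)⁻¹ : ℂ) ^ l.length else 0 := by
  induction l generalizing y with
  | nil => simp [listMatrix, Matrix.one_apply, funext_iff]
  | cons i l ih =>
    rw [List.nodup_cons] at hl
    have hne (j : ι) (hj : j ∈ l) : t j ≠ t i := fun e => hl.1 (hinj e ▸ hj)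
    have hy' (a : Bool) (j : ι) (hj : j ∈ l) : Function.update y (t i) a (t j) = false := by
      rw [Function.update_of_ne (hne j hj), hy j (List.mem_cons_of_mem i hj)]
    have hU (a : Bool) : (hadamardUnitary : Matrix Bool Bool ℂ) a (y (t i)) = ((√2)⁻¹ : ℂ) := by
      simp [hadamardUnitary, hy i List.mem_cons_self]
    have hiff (a : Bool) : (∀ w, (∀ j ∈ l, w ≠ t j) → x w = Function.update y (t i) a w) ↔
        a = x (t i) ∧ ∀ w, (∀ j ∈ i :: l, w ≠ t j) → x w = y w := by
      grind
    rw [List.map_cons, listMatrix, mul_toMatrix_elementary_apply]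
    simp only [ih hl.2 (hy' _), hU, hiff, ite_and, ite_mul, zero_mul, Finset.sum_ite_eq',
      Finset.mem_univ, if_true, List.length_cons, pow_succ]

end Gates

section StepGates

variable {Q N b : ℕ}

/-- The ancillas of one step: a displacement `d`, which is added to the row index to give the column
index, a flag, and the two words that receive the output of the oracle. -/
abbrev StepAnc (N b : ℕ) : Type := (Fin (width N) ⊕ Unit) ⊕ (Fin (b + 1) ⊕ Fin (b + 1))

/-- The qubits of one step. -/
abbrev StepWire (Q N b : ℕ) : Type := SysWire Q N ⊕ StepAnc N b

/-- The qubits that hold the number `q` of the matrix. -/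
abbrev wBlock (i : Fin (width Q)) : StepWire Q N b := .inl (.inl i)

/-- The qubits that hold the row index. -/
abbrev wRow (i : Fin (width N)) : StepWire Q N b := .inl (.inr i)

/-- The qubits that hold the displacement, and the column index during the oracle calls. -/
abbrev wCol (i : Fin (width N)) : StepWire Q N b := .inr (.inl (.inl i))

/-- The flag. -/
abbrev wFlag : StepWire Q N b := .inr (.inl (.inr ()))

/-- The qubits that hold the real part of the entry. -/
abbrev wRe (i : Fin (b + 1)) : StepWire Q N b := .inr (.inr (.inl i))

/-- The qubits that hold the imaginary part of the entry. -/
abbrev wIm (i : Fin (b + 1)) : StepWire Q N b := .inr (.inr (.inr i))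

/-- Add the displacement to the row index if the flag is set. -/
def addRow (y : StepWire Q N b → Bool) : StepWire Q N b → Bool :=
  Sum.elim (Sum.elim (fun i => y (wBlock i)) fun i => y (wRow i) ^^ (y wFlag && y (wCol i)))
    fun w => y (.inr w)

/-- Add the row index to the displacement, which gives the column index. -/
def addCol (y : StepWire Q N b → Bool) : StepWire Q N b → Bool :=
  Sum.elim (fun w => y (.inl w))
    (Sum.elim (Sum.elim (fun i => y (wCol i) ^^ y (wRow i)) fun _ => y wFlag)
      fun w => y (.inr (.inr w)))

/-- The action of the oracle on basis states. -/
def oracleMap (Z : Table Q N b) (y : StepWire Q N b → Bool) : StepWire Q N b → Bool :=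
  let s := Z.lookup (fun i => y (wBlock i)) (fun i => y (wRow i)) (fun i => y (wCol i))
  Sum.elim (fun w => y (.inl w)) (Sum.elim (fun w => y (.inr (.inl w)))
    (Sum.elim (fun i => y (wRe i) ^^ s.1 i) fun i => y (wIm i) ^^ s.2 i))

theorem addRow_involutive : (addRow : (StepWire Q N b → Bool) → _).Involutive := by
  intro y
  ext ((i | i) | ((i | i) | (i | i))) <;> simp [addRow]

theorem addCol_involutive : (addCol : (StepWire Q N b → Bool) → _).Involutive := by
  intro y
  ext ((i | i) | ((i | i) | (i | i))) <;> simp [addCol]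

theorem oracleMap_involutive (Z : Table Q N b) : (oracleMap Z).Involutive := by
  intro y
  ext ((i | i) | ((i | i) | (i | i))) <;> simp [oracleMap]

/-- The position of the address and output registers of the oracle. -/
def oraclePlace (Q N b : ℕ) : OracleWire Q N b ↪ StepWire Q N b where
  toFun
    | .block i => wBlock i
    | .row i => wRow i
    | .col i => wCol i
    | .re i => wRe i
    | .im i => wIm i
  inj' := by
    intro v w h
    cases v <;> cases w <;> simp_all

/-- The circuit for `addRow`. -/
def rowGates (Q N b : ℕ) : List (Gate Q N b (StepWire Q N b)) :=
  (List.finRange (width N)).map fun i =>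
    .elementary {wFlag, wCol i} Finset.card_le_two (wRow i) (by simp) notUnitary

/-- The circuit for `addCol`. -/
def colGates (Q N b : ℕ) : List (Gate Q N b (StepWire Q N b)) :=
  (List.finRange (width N)).map fun i =>
    .elementary {wRow i} (by simp) (wCol i) (by simp) notUnitary

theorem toMatrix_oraclePlace (Z : Table Q N b) :
    (Gate.oracle (oraclePlace Q N b)).toMatrix Z = basisMap (oracleMap Z) := by
  ext x y
  rw [Gate.toMatrix, Matrix.of_apply, basisMap_apply]
  refine if_congr ⟨fun h => ?_, ?_⟩ rfl rfl
  · ext ((i | i) | ((i | _) | (i | i)))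
    exacts [h.2.2 (wBlock i) nofun nofun,
      h.2.2 (wRow i) nofun nofun,
      h.2.2 (wCol i) nofun nofun,
      h.2.2 wFlag nofun nofun, h.1 i, h.2.1 i]
  · rintro rfl
    refine ⟨fun _ => rfl, fun _ => rfl, ?_⟩
    rintro ((i | i) | ((i | i) | (i | i))) hre him
    exacts [rfl, rfl, rfl, rfl, absurd rfl (hre i), absurd rfl (him i)]

theorem listMatrix_rowGates (Z : Table Q N b) :
    listMatrix Z (rowGates Q N b) = basisMap addRow := by
  refine (listMatrix_map_not Z (fun _ => Finset.card_le_two) (by simp)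
    (fun i j h => by simpa using h) (List.nodup_finRange _)).trans ?_
  congr 1
  ext y ((i | i) | ((i | i) | (i | i))) <;> simp [addRow, Bool.decide_and]

theorem listMatrix_colGates (Z : Table Q N b) :
    listMatrix Z (colGates Q N b) = basisMap addCol := by
  refine (listMatrix_map_not Z (fun _ => by simp) (by simp) (fun i j h => by simpa using h)
    (List.nodup_finRange _)).trans ?_
  congr 1
  ext y ((i | i) | ((i | i) | (i | i))) <;> simp [addCol]

/-- The circuit that computes the column index and looks up the entry. -/
def loadGates (Q N b : ℕ) : List (Gate Q N b (StepWire Q N b)) :=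
  rowGates Q N b ++ colGates Q N b ++ [.oracle (oraclePlace Q N b)]

/-- The circuit that undoes `loadGates`. -/
def unloadGates (Q N b : ℕ) : List (Gate Q N b (StepWire Q N b)) :=
  .oracle (oraclePlace Q N b) :: (colGates Q N b ++ rowGates Q N b)

theorem listMatrix_loadGates (Z : Table Q N b) :
    listMatrix Z (loadGates Q N b) = basisMap (oracleMap Z ∘ addCol ∘ addRow) := by
  simp only [loadGates, listMatrix_append, listMatrix_rowGates, listMatrix_colGates, listMatrix,
    toMatrix_oraclePlace, one_mul, basisMap_mul_basisMap]

theorem listMatrix_unloadGates_mul_loadGates (Z : Table Q N b) :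
    listMatrix Z (unloadGates Q N b) * listMatrix Z (loadGates Q N b) = 1 := by
  simp only [listMatrix_loadGates, unloadGates, listMatrix_append, listMatrix_rowGates,
    listMatrix_colGates, listMatrix, toMatrix_oraclePlace, basisMap_mul_basisMap, ← basisMap_id]
  congr 1
  ext1 y
  simp only [Function.comp_apply, oracleMap_involutive Z _, addCol_involutive _,
    addRow_involutive _, id]

/-- The axis of the rotations for the real parts. -/
def reAxis : Bool → ℂ := fun _ => -Complex.I

/-- The axis of the rotations for the imaginary parts. -/
def imAxis : Bool → ℂ := fun a => if a then -1 else 1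

theorem isAxis_reAxis : IsAxis reAxis := by
  intro c
  simp [reAxis]

theorem isAxis_imAxis : IsAxis imAxis := by
  intro c
  cases c <;> simp [imAxis]

/-- The contribution of the digit `i` to a fixed-point number with unit `u`. -/
noncomputable def digitValue (u : ℝ) {b : ℕ} (i : Fin (b + 1)) : ℝ :=
  if i = Fin.last b then -(u * 2 ^ b) else u * 2 ^ (i : ℕ)

theorem sum_digitValue (u : ℝ) (z : Fin (b + 1) → Bool) :
    ((List.finRange (b + 1)).map fun i => if z i = true then digitValue u i else 0).sum =
      fixedPoint u z := by
  rw [← Fin.sum_univ_def, Fin.sum_univ_castSucc, fixedPoint, mul_sub, Finset.mul_sum,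
    sub_eq_add_neg]
  congr 1
  · simp [digitValue, (Fin.castSucc_lt_last _).ne]
  · simp only [digitValue, if_true]
    split_ifs <;> simp

/-- Rotations of the flag about the axis `p`, controlled by the digits of a word. -/
noncomputable def rotationGates {p : Bool → ℂ} (hp : IsAxis p) (u : ℝ)
    (v : Fin (b + 1) → Fin (b + 1) ⊕ Fin (b + 1)) : List (Gate Q N b (StepWire Q N b)) :=
  (List.finRange (b + 1)).map fun i => .elementary {.inr (.inr (v i))} (by simp) wFlag (by simp)
    (rotationUnitary hp (digitValue u i))

theorem listMatrix_rotationGates (Z : Table Q N b) {p : Bool → ℂ} (hp : IsAxis p) (u : ℝ)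
    (v : Fin (b + 1) → Fin (b + 1) ⊕ Fin (b + 1)) :
    listMatrix Z (rotationGates hp u v) = rotation (flipQubit wFlag) (fun y => y wFlag) p
      fun y => fixedPoint u fun i => y (.inr (.inr (v i))) := by
  simp only [← sum_digitValue]
  exact listMatrix_map_rotation Z hp _ _ _ _

/-- Hadamard gates on the displacement and the flag. -/
noncomputable def hadamardGates (Q N b : ℕ) : List (Gate Q N b (StepWire Q N b)) :=
  (Finset.univ : Finset (Fin (width N) ⊕ Unit)).toList.map fun i =>
    .elementary ∅ (by simp) (.inr (.inl i)) (by simp) hadamardUnitary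

/-- The gates of one step. -/
noncomputable def stepGates (Q N b : ℕ) (u : ℝ) : List (Gate Q N b (StepWire Q N b)) :=
  hadamardGates Q N b ++ loadGates Q N b ++ rotationGates isAxis_reAxis u .inl ++
    rotationGates isAxis_imAxis u .inr ++ unloadGates Q N b

theorem sum_time_stepGates (u : ℝ) (τ : ℕ) :
    ((stepGates Q N b u).map (Gate.time τ)).sum = 5 * width N + 2 * (b + 1) + 1 + 2 * τ := by
  simp [stepGates, hadamardGates, loadGates, unloadGates, rowGates, colGates, rotationGates,
    Function.comp_def, Gate.time]
  ring

end StepGates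

section StepMatrix

variable {Q N b : ℕ}

/-- The basis states of the displacement and the flag. -/
abbrev StepReg (N : ℕ) : Type := (Fin (width N) → Bool) × Bool

/-- The basis state of the ancillas of a step with displacement and flag `k` and empty words. -/
def regLabel (b : ℕ) {N : ℕ} (k : StepReg N) : StepAnc N b → Bool :=
  Sum.elim (Sum.elim k.1 fun _ => k.2) fun _ => false

theorem regLabel_injective : (regLabel b : StepReg N → _).Injective :=
  fun _ _ h =>
    Prod.ext (funext fun i => congrFun h (.inl (.inl i))) (congrFun h (.inl (.inr ())))

/-- The basis state of the qubits of a step with displacement and flag `s.2` and empty words. -/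
def stepLabel (Q N b : ℕ) (s : (SysWire Q N → Bool) × StepReg N) : StepWire Q N b → Bool :=
  Sum.elim s.1 (regLabel b s.2)

theorem stepLabel_injective : (stepLabel Q N b).Injective := by
  rintro ⟨x, k⟩ ⟨x', k'⟩ h
  rw [stepLabel, stepLabel, Sum.elim_eq_iff] at h
  exact Prod.ext h.1 (regLabel_injective h.2)

/-- Flip the flag and add the displacement to the row index. -/
def exchange (s : (SysWire Q N → Bool) × StepReg N) : (SysWire Q N → Bool) × StepReg N :=
  (Sum.elim (fun i => s.1 (.inl i)) fun i => s.1 (.inr i) ^^ s.2.1 i, s.2.1, !s.2.2)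

theorem exchange_involutive :
    (exchange : (SysWire Q N → Bool) × StepReg N → _).Involutive := by
  rintro ⟨x, d, c⟩
  simp only [exchange, Prod.mk.injEq, Bool.not_not, and_true]
  ext (i | i) <;> simp

/-- The addresses of entries: number of the matrix, row and column, in binary. -/
abbrev Address (Q N : ℕ) : Type :=
  (Fin (width Q) → Bool) × (Fin (width N) → Bool) × (Fin (width N) → Bool)

/-- The address that the registers hold after `addRow` and `addCol`. -/
def loadedAddress (s : (SysWire Q N → Bool) × StepReg N) : Address Q N :=
  (fun i => s.1 (.inl i), fun i => s.1 (.inr i) ^^ (s.2.2 && s.2.1 i),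
    fun i => s.2.1 i ^^ (s.1 (.inr i) ^^ (s.2.2 && s.2.1 i)))

theorem loadedAddress_exchange (s : (SysWire Q N → Bool) × StepReg N) :
    loadedAddress (exchange s) = loadedAddress s := by
  obtain ⟨x, d, c⟩ := s
  cases c <;> simp [loadedAddress, exchange]

/-- The word that a table holds at an address. -/
def Table.word (Z : Table Q N b) (a : Address Q N) : Word b := Z.lookup a.1 a.2.1 a.2.2

theorem flipQubit_comp_load (Z : Table Q N b) :
    flipQubit wFlag ∘ (oracleMap Z ∘ addCol ∘ addRow) ∘ stepLabel Q N b =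
      ((oracleMap Z ∘ addCol ∘ addRow) ∘ stepLabel Q N b) ∘ exchange := by
  ext ⟨x, d, c⟩ ((i | i) | ((i | i) | (i | i))) <;> cases c <;>
    simp [flipQubit, oracleMap, addCol, addRow, stepLabel, regLabel, exchange]

/-- The unitary of the rotations in a step, in terms of the displacement and the flag before the
entry is looked up. -/
noncomputable def stepMatrix (Z : Table Q N b) (u : ℝ) :
    Matrix ((SysWire Q N → Bool) × StepReg N) ((SysWire Q N → Bool) × StepReg N) ℂ :=
  rotation exchange (fun s => s.2.2) imAxis (fun s => fixedPoint u (Z.word (loadedAddress s)).2) *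
    rotation exchange (fun s => s.2.2) reAxis fun s => fixedPoint u (Z.word (loadedAddress s)).1

/-- The uniform superposition of the displacements and flags. -/
noncomputable def uniformState (N : ℕ) : StepReg N → ℂ := fun _ => ((√2)⁻¹ : ℂ) ^ (width N + 1)

/-- The addition of the uniform superposition of the displacements and flags. -/
noncomputable def uniformIsometry (Q N : ℕ) :
    Matrix ((SysWire Q N → Bool) × StepReg N) (SysWire Q N → Bool) ℂ :=
  adjoin (SysWire Q N → Bool) (uniformState N)

theorem norm_uniformState_sq (k : StepReg N) : ‖uniformState N k‖ ^ 2 = (2 ^ (width N + 1))⁻¹ := by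
  rw [uniformState, norm_pow, ← pow_mul, mul_comm, pow_mul, norm_inv, Complex.norm_real, inv_pow,
    Real.norm_eq_abs, sq_abs, Real.sq_sqrt zero_le_two, inv_pow]

theorem listMatrix_hadamardGates_mul_zeroAncillas (Z : Table Q N b) :
    listMatrix Z (hadamardGates Q N b) * zeroAncillas (SysWire Q N) (StepAnc N b) =
      basisMap (stepLabel Q N b) * uniformIsometry Q N := by
  ext x y
  have hentry : listMatrix Z (hadamardGates Q N b) x (Sum.elim y fun _ => false) = _ :=
    listMatrix_map_hadamard_apply Z (by simp) (by simp) (fun i j h => by simpa using h)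
      (Finset.nodup_toList _) x (by simp)
  rw [zeroAncillas, mul_basisMap_apply, hentry]
  by_cases hx : x ∈ Set.range (stepLabel Q N b)
  · obtain ⟨s, rfl⟩ := hx
    rw [basisMap_mul_apply_of_injective stepLabel_injective]
    simp [uniformIsometry, adjoin, uniformState, stepLabel, regLabel, funext_iff]
  · rw [basisMap_mul_apply_of_notMem_range hx, if_neg]
    refine fun h => hx ⟨(y, fun i => x (wCol i), x wFlag), ?_⟩
    ext ((i | i) | ((i | _) | (i | i))) <;> simp [stepLabel, regLabel, h]

theorem listMatrix_stepGates_mul_zeroAncillas (Z : Table Q N b) (u : ℝ) :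
    listMatrix Z (stepGates Q N b u) * zeroAncillas (SysWire Q N) (StepAnc N b) =
      basisMap (stepLabel Q N b) * (stepMatrix Z u * uniformIsometry Q N) := by
  set L := (oracleMap Z ∘ addCol ∘ addRow) ∘ stepLabel Q N b with hL
  have hload : listMatrix Z (loadGates Q N b) * basisMap (stepLabel Q N b) = basisMap L := by
    rw [listMatrix_loadGates, basisMap_mul_basisMap]
  have hunload : listMatrix Z (unloadGates Q N b) * basisMap L = basisMap (stepLabel Q N b) := by
    rw [← hload, ← Matrix.mul_assoc, listMatrix_unloadGates_mul_loadGates, Matrix.one_mul]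
  have hrotate {p : Bool → ℂ} (hp : IsAxis p) (v : Fin (b + 1) → Fin (b + 1) ⊕ Fin (b + 1)) :
      listMatrix Z (rotationGates hp u v) * basisMap L = basisMap L *
        rotation exchange (fun s => s.2.2) p fun s => fixedPoint u fun i =>
          L s (.inr (.inr (v i))) := by
    rw [listMatrix_rotationGates, rotation_mul_basisMap (flipQubit_comp_load Z)]
    rfl
  have hwords : stepMatrix Z u =
      rotation exchange (fun s => s.2.2) imAxis (fun s => fixedPoint u fun i => L s (wIm i)) *
        rotation exchange (fun s => s.2.2) reAxis fun s => fixedPoint u fun i => L s (wRe i) := by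
    simp [stepMatrix, hL, oracleMap, addCol, addRow, stepLabel, regLabel, Table.word, loadedAddress]
  simp only [stepGates, listMatrix_append, Matrix.mul_assoc,
    listMatrix_hadamardGates_mul_zeroAncillas]
  rw [← Matrix.mul_assoc _ (basisMap _), hload, ← Matrix.mul_assoc _ (basisMap L),
    hrotate isAxis_reAxis, Matrix.mul_assoc, ← Matrix.mul_assoc _ (basisMap L),
    hrotate isAxis_imAxis, Matrix.mul_assoc, ← Matrix.mul_assoc _ (basisMap L), hunload, hwords]
  simp only [Matrix.mul_assoc]

end StepMatrix

section StepCircuit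

theorem krausOp_onWires_sumMap {S A A' : Type} [Fintype S] [DecidableEq S] [Fintype A]
    [Fintype A'] [DecidableEq A'] (e : A ≃ A') (L : Matrix (S ⊕ A → Bool) (S ⊕ A → Bool) ℂ)
    (z : A' → Bool) :
    krausOp (onWires ((Function.Embedding.refl S).sumMap e.toEmbedding) L) z =
      krausOp L (z ∘ e) := by
  have hcomp (x : S → Bool) (z : A' → Bool) :
      Sum.elim x z ∘ (Function.Embedding.refl S).sumMap e.toEmbedding = Sum.elim x (z ∘ e) := by
    ext (i | i) <;> rfl
  ext x y
  rw [krausOp, Matrix.submatrix_apply, onWires_apply, hcomp, hcomp, if_pos]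
  · rfl
  · rintro (w | w) hw
    exacts [absurd ⟨.inl w, rfl⟩ hw, absurd ⟨.inr (e.symm w), by simp⟩ hw]

theorem krausOp_eq_submatrix {S A : Type} [Fintype S] [DecidableEq S] [Fintype A] [DecidableEq A]
    (L : Matrix (S ⊕ A → Bool) (S ⊕ A → Bool) ℂ) (z : A → Bool) :
    krausOp L z = (L * zeroAncillas S A).submatrix (fun x => Sum.elim x z) id := by
  ext x y
  exact (mul_basisMap_apply _ _ _ _).symm

variable {Q N b : ℕ}

/-- One step of the simulation, as a circuit. -/
noncomputable def stepCircuit (Q N b : ℕ) (u : ℝ) : Circuit Q N b where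
  ancillas := Fintype.card (StepAnc N b)
  gates := (stepGates Q N b u).map (Gate.map
    ((Function.Embedding.refl _).sumMap (Fintype.equivFin (StepAnc N b)).toEmbedding))

theorem time_stepCircuit (u : ℝ) (τ : ℕ) :
    (stepCircuit Q N b u).time τ = 6 * width N + 4 * (b + 1) + 2 + 2 * τ := by
  rw [Circuit.time, stepCircuit, List.map_map, funext (Gate.time_map τ _) (f := _ ∘ _),
    sum_time_stepGates]
  simp only [Fintype.card_sum, Fintype.card_fin, Fintype.card_unit]
  ring

theorem kraus_stepCircuit (Z : Table Q N b) (u : ℝ)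
    (z : Fin (Fintype.card (StepAnc N b)) → Bool) :
    (stepCircuit Q N b u).kraus Z z =
      (basisMap (stepLabel Q N b) *
        (stepMatrix Z u * uniformIsometry Q N)).submatrix
          (fun x => Sum.elim x (z ∘ Fintype.equivFin (StepAnc N b))) id := by
  have h := krausOp_onWires_sumMap (Fintype.equivFin (StepAnc N b))
    (listMatrix Z (stepGates Q N b u)) z
  rwa [← listMatrix_map, krausOp_eq_submatrix (listMatrix Z (stepGates Q N b u)),
    listMatrix_stepGates_mul_zeroAncillas] at h

theorem krausDual_stepCircuit (Z : Table Q N b) (u : ℝ) {R : Type*} [Fintype R] [DecidableEq R]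
    (O : Matrix (R × (SysWire Q N → Bool)) (R × (SysWire Q N → Bool)) ℂ) :
    krausDual ((stepCircuit Q N b u).kraus Z) O =
      krausDual (fun k => (stepMatrix Z u *
        uniformIsometry Q N).submatrix (·, k) id) O := by
  set E := Fintype.equivFin (StepAnc N b)
  set e : StepReg N → Fin (Fintype.card (StepAnc N b)) → Bool := fun k => regLabel b k ∘ E.symm
    with he
  have hinj : e.Injective :=
    E.symm.surjective.injective_comp_right.comp regLabel_injective
  have hrows : (fun k => (stepMatrix Z u *
      uniformIsometry Q N).submatrix (·, k) id) =
      (stepCircuit Q N b u).kraus Z ∘ e := by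
    funext k
    ext x y
    have hlabel : Sum.elim x (e k ∘ E) = stepLabel Q N b (x, k) := by
      simp [he, stepLabel, Function.comp_assoc]
    have hentry := congrFun₂ (kraus_stepCircuit Z u (e k)) x y
    rw [Matrix.submatrix_apply, hlabel,
      basisMap_mul_apply_of_injective stepLabel_injective] at hentry
    exact hentry.symm
  rw [hrows]
  refine (krausDual_comp_of_injective hinj (fun z hz => ?_) O).symm
  ext x y
  rw [kraus_stepCircuit, Matrix.submatrix_apply, basisMap_mul_apply_of_notMem_range]
  · rfl
  · rintro ⟨⟨x', k⟩, h⟩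
    refine hz ⟨k, ?_⟩
    rw [stepLabel, Sum.elim_eq_iff] at h
    have hz' : regLabel b k = z ∘ E := h.2
    change regLabel b k ∘ E.symm = z
    rw [hz', Function.comp_assoc, E.self_comp_symm, Function.comp_id]

end StepCircuit

section SmallRotation

variable {α : Type*} [Fintype α] [DecidableEq α] {F : α → α} {a : α → Bool} {p : Bool → ℂ}
  {θ : α → ℝ} {m : ℝ}

theorem norm_diagonal_le {g : α → ℂ} (hm : 0 ≤ m) (hg : ∀ y, ‖g y‖ ≤ m) :
    ‖Matrix.diagonal g‖ ≤ m := by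
  rw [Matrix.l2_opNorm_diagonal]
  exact (pi_norm_le_iff_of_nonneg hm).2 hg

theorem norm_diagonal_mul_basisMap_le {g : α → ℂ} (hF : F.Injective) (hm : 0 ≤ m)
    (hg : ∀ y, ‖g y‖ ≤ m) : ‖Matrix.diagonal g * basisMap F‖ ≤ m :=
  calc ‖Matrix.diagonal g * basisMap F‖ ≤ ‖Matrix.diagonal g‖ * ‖basisMap F‖ :=
        Matrix.l2_opNorm_mul _ _
    _ ≤ m * 1 := by gcongr; exacts [norm_diagonal_le hm hg, norm_basisMap_le hF]
    _ = m := mul_one m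

/-- The first-order term of a rotation in its angles. -/
noncomputable def tangent (F : α → α) (a : α → Bool) (p : Bool → ℂ) (θ : α → ℝ) : Matrix α α ℂ :=
  Matrix.diagonal (fun y => p (a y) * (θ y : ℂ)) * basisMap F

theorem norm_tangent_le (hF : F.Injective) (hp : ∀ c, ‖p c‖ = 1) (hm : 0 ≤ m)
    (hθ : ∀ y, |θ y| ≤ m) : ‖tangent F a p θ‖ ≤ m :=
  norm_diagonal_mul_basisMap_le hF hm fun y => by simpa [hp] using hθ y

theorem abs_sin_sub_self_le {x : ℝ} (hx : |x| ≤ 1) : |Real.sin x - x| ≤ x ^ 2 / 2 := by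
  have hsin := abs_le.1 (Real.sin_bound hx)
  have hcube : |x| ^ 3 ≤ x ^ 2 := by
    rw [← sq_abs x]
    exact pow_le_pow_of_le_one (abs_nonneg x) hx (by norm_num)
  have hfifth : |x| ^ 5 ≤ x ^ 2 := by
    rw [← sq_abs x]
    exact pow_le_pow_of_le_one (abs_nonneg x) hx (by norm_num)
  have hcube' := abs_le.1 ((abs_pow x 3).trans_le hcube)
  rw [abs_le]
  constructor <;> linarith [sq_nonneg x]

theorem norm_rotation_sub_le (hF : F.Injective) (hp : ∀ c, ‖p c‖ = 1) (hm1 : m ≤ 1)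
    (hθ : ∀ y, |θ y| ≤ m) : ‖rotation F a p θ - 1 - tangent F a p θ‖ ≤ m ^ 2 := by
  have hsq (y : α) : θ y ^ 2 ≤ m ^ 2 := sq_le_sq' (abs_le.1 (hθ y)).1 (abs_le.1 (hθ y)).2
  have hcos : ‖Matrix.diagonal fun y => ((Real.cos (θ y) - 1 : ℝ) : ℂ)‖ ≤ m ^ 2 / 2 := by
    refine norm_diagonal_le (by positivity) fun y => ?_
    rw [Complex.norm_real, Real.norm_eq_abs, abs_le]
    constructor <;>
      linarith [Real.cos_le_one (θ y), Real.one_sub_sq_div_two_le_cos (x := θ y), hsq y,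
        sq_nonneg m]
  have hsin : ‖Matrix.diagonal (fun y => p (a y) * ((Real.sin (θ y) - θ y : ℝ) : ℂ)) *
      basisMap F‖ ≤ m ^ 2 / 2 := by
    refine norm_diagonal_mul_basisMap_le hF (by positivity) fun y => ?_
    rw [norm_mul, hp, one_mul, Complex.norm_real, Real.norm_eq_abs]
    linarith [abs_sin_sub_self_le ((hθ y).trans hm1), hsq y]
  calc ‖rotation F a p θ - 1 - tangent F a p θ‖
      = ‖Matrix.diagonal (fun y => ((Real.cos (θ y) - 1 : ℝ) : ℂ)) +
          Matrix.diagonal (fun y => p (a y) * ((Real.sin (θ y) - θ y : ℝ) : ℂ)) * basisMap F‖ := by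
        rw [rotation, tangent, ← Matrix.diagonal_one, add_sub_right_comm, Matrix.diagonal_sub,
          add_sub_assoc, ← Matrix.sub_mul, Matrix.diagonal_sub]
        simp [mul_sub]
    _ ≤ m ^ 2 / 2 + m ^ 2 / 2 := norm_add_le_of_le hcos hsin
    _ = m ^ 2 := add_halves _

theorem norm_mul_sub_one_sub_add_le {R : Type*} [NormedRing R] {x y α β : R} (hm : 0 ≤ m)
    (hm1 : m ≤ 1) (hx : ‖x - 1 - α‖ ≤ m ^ 2) (hy : ‖y - 1 - β‖ ≤ m ^ 2) (hα : ‖α‖ ≤ m)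
    (hβ : ‖β‖ ≤ m) : ‖x * y - 1 - (α + β)‖ ≤ 6 * m ^ 2 := by
  have hexpand : x * y - 1 - (α + β) = (x - 1 - α) + (y - 1 - β) + α * β +
      (α * (y - 1 - β) + (x - 1 - α) * β + (x - 1 - α) * (y - 1 - β)) := by
    noncomm_ring
  have hmul {c d : R} {s t : ℝ} (hc : ‖c‖ ≤ s) (hd : ‖d‖ ≤ t) : ‖c * d‖ ≤ s * t :=
    (norm_mul_le _ _).trans
      (mul_le_mul hc hd (norm_nonneg _) ((norm_nonneg _).trans hc))
  calc ‖x * y - 1 - (α + β)‖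
      ≤ (m ^ 2 + m ^ 2 + m * m) + (m * m ^ 2 + m ^ 2 * m + m ^ 2 * m ^ 2) := by
        rw [hexpand]
        exact norm_add_le_of_le
          (norm_add_le_of_le (norm_add_le_of_le hx hy) (hmul hα hβ))
          (norm_add_le_of_le (norm_add_le_of_le (hmul hα hy) (hmul hx hβ)) (hmul hx hy))
    _ ≤ 6 * m ^ 2 := by nlinarith [sq_nonneg m, pow_le_one₀ (n := 2) hm hm1]

end SmallRotation

section Generator

variable {Q N b : ℕ} {f : Address Q N → ℂ} {m : ℝ}

/-- The Hamiltonian of a step to first order, if `f` is the function of addresses that the oracle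
computes. -/
noncomputable def generator (f : Address Q N → ℂ) :
    Matrix ((SysWire Q N → Bool) × StepReg N) ((SysWire Q N → Bool) × StepReg N) ℂ :=
  Matrix.diagonal (fun s => if s.2.2 then star (f (loadedAddress s)) else f (loadedAddress s)) *
    basisMap exchange

theorem generator_sub (f g : Address Q N → ℂ) :
    generator f - generator g = generator (f - g) := by
  rw [generator, generator, generator, ← Matrix.sub_mul, Matrix.diagonal_sub]
  congr 2
  funext s
  simp only [Pi.sub_apply, star_sub]
  split_ifs <;> rfl

theorem norm_generator_le (hm : 0 ≤ m) (hf : ∀ a, ‖f a‖ ≤ m) : ‖generator f‖ ≤ m := by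
  refine norm_diagonal_mul_basisMap_le exchange_involutive.injective hm fun s => ?_
  split_ifs
  · exact (norm_star _).trans_le (hf _)
  · exact hf _

theorem tangent_imAxis_add_tangent_reAxis (Z : Table Q N b) (u : ℝ) :
    tangent exchange (fun s => s.2.2) imAxis
        (fun s => fixedPoint u (Z.word (loadedAddress s)).2) +
      tangent exchange (fun s => s.2.2) reAxis
        (fun s => fixedPoint u (Z.word (loadedAddress s)).1) =
    (-Complex.I) • generator fun a => (Z.word a).value u := by
  rw [generator, tangent, tangent, ← Matrix.add_mul, Matrix.diagonal_add, ← Matrix.smul_mul,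
    ← Matrix.diagonal_smul]
  congr 2
  ext ⟨x, d, c⟩
  cases c <;> apply Complex.ext <;> simp [imAxis, reAxis, Word.value]

theorem norm_stepMatrix_sub_le (Z : Table Q N b) (u : ℝ) (hm : 0 ≤ m) (hm1 : m ≤ 1)
    (hZ : ∀ a, ‖(Z.word a).value u‖ ≤ m) :
    ‖stepMatrix Z u - 1 - (-Complex.I) • generator fun a => (Z.word a).value u‖ ≤ 6 * m ^ 2 := by
  have hre (s : (SysWire Q N → Bool) × StepReg N) :
      |fixedPoint u (Z.word (loadedAddress s)).1| ≤ m :=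
    (Complex.abs_re_le_norm (Word.value u _)).trans (hZ _)
  have him (s : (SysWire Q N → Bool) × StepReg N) :
      |fixedPoint u (Z.word (loadedAddress s)).2| ≤ m :=
    (Complex.abs_im_le_norm (Word.value u _)).trans (hZ _)
  have hreAxis (c : Bool) : ‖reAxis c‖ = 1 := by simp [reAxis]
  have himAxis (c : Bool) : ‖imAxis c‖ = 1 := by cases c <;> simp [imAxis]
  have hexchange := (exchange_involutive (Q := Q) (N := N)).injective
  rw [stepMatrix, ← tangent_imAxis_add_tangent_reAxis]
  exact norm_mul_sub_one_sub_add_le hm hm1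
    (norm_rotation_sub_le hexchange himAxis hm1 him)
    (norm_rotation_sub_le hexchange hreAxis hm1 hre)
    (norm_tangent_le hexchange himAxis hm him) (norm_tangent_le hexchange hreAxis hm hre)

theorem norm_stepMatrix_le (Z : Table Q N b) (u : ℝ) : ‖stepMatrix Z u‖ ≤ 1 := by
  have hflag (s : (SysWire Q N → Bool) × StepReg N) : (exchange s).2.2 = !s.2.2 := rfl
  refine (Matrix.l2_opNorm_mul _ _).trans (mul_le_one₀ ?_ (norm_nonneg _) ?_) <;>
    refine norm_rotation_le exchange_involutive hflag ?_ fun s => by rw [loadedAddress_exchange]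
  exacts [isAxis_imAxis, isAxis_reAxis]

end Generator

section Compression

variable {Q N : ℕ} {f : Address Q N → ℂ}

theorem sum_norm_uniformState_sq : ∑ k : StepReg N, ‖uniformState N k‖ ^ 2 = 1 := by
  simp only [norm_uniformState_sq, Finset.sum_const, nsmul_eq_mul]
  rw [Finset.card_univ, Fintype.card_prod, Fintype.card_fun, Fintype.card_bool, Fintype.card_fin,
    ← pow_succ]
  push_cast
  exact mul_inv_cancel₀ (by positivity)

theorem conjTranspose_uniformIsometry_mul_self :
    (uniformIsometry Q N)ᴴ * uniformIsometry Q N = 1 :=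
  conjTranspose_adjoin_mul_self sum_norm_uniformState_sq

/-- The matrix on the system with blocks given by a function of addresses. -/
def addressMatrix (f : Address Q N → ℂ) : Matrix (SysWire Q N → Bool) (SysWire Q N → Bool) ℂ :=
  fun x x' =>
    if x ∘ Sum.inl = x' ∘ Sum.inl then f (x ∘ Sum.inl, x ∘ Sum.inr, x' ∘ Sum.inr) else 0

/-- The displacement `k.1` links each row to exactly one column. -/
theorem generator_apply (hf : ∀ q i j, star (f (q, i, j)) = f (q, j, i)) (x x' : SysWire Q N → Bool)
    (k k' : StepReg N) :
    generator f (x, k) (x', k') =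
      if k' = (k.1, !k.2) ∧ k.1 = (fun i => x (.inr i) ^^ x' (.inr i)) then addressMatrix f x x'
      else 0 := by
  obtain ⟨d, c⟩ := k
  have hentry : (x, d, c) = exchange (x', k') ↔ k' = (d, !c) ∧
      d = (fun i => x (.inr i) ^^ x' (.inr i)) ∧ x ∘ Sum.inl = x' ∘ Sum.inl := by
    obtain ⟨d', c'⟩ := k'
    have hxor (i : Fin (width N)) : x (.inr i) = (x' (.inr i) ^^ d' i) ↔
        d' i = (x (.inr i) ^^ x' (.inr i)) := by
      cases x (.inr i) <;> cases x' (.inr i) <;> cases d' i <;> decide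
    have hnot : c = !c' ↔ c' = !c := by cases c <;> cases c' <;> decide
    simp only [exchange, Prod.mk.injEq, funext_iff, Sum.forall, Sum.elim_inl, Sum.elim_inr,
      Function.comp_apply, hxor, hnot]
    grind
  have hvalue (hd : d = fun i => x (.inr i) ^^ x' (.inr i)) :
      (if c then star (f (loadedAddress (x, d, c))) else f (loadedAddress (x, d, c))) =
        f (x ∘ Sum.inl, x ∘ Sum.inr, x' ∘ Sum.inr) := by
    have hcancel (p q : Bool) : (p != (q != p)) = q := by decide +revert
    subst hd
    cases c <;> simp only [loadedAddress, hf, Bool.true_and, Bool.false_and, if_true] <;>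
      simp [Function.comp_def, hcancel]
  simp only [generator, Matrix.diagonal_mul, basisMap_apply, hentry, addressMatrix]
  grind

theorem star_uniformState_mul (k k' : StepReg N) :
    star (uniformState N k) * uniformState N k' = (2 ^ (width N + 1))⁻¹ := by
  have hsq := norm_uniformState_sq k
  rw [show uniformState N k' = uniformState N k from rfl, RCLike.star_def, Complex.conj_mul']
  rw [← Complex.ofReal_pow, hsq]
  push_cast
  rfl

theorem compression_generator (hf : ∀ q i j, star (f (q, i, j)) = f (q, j, i)) :
    (uniformIsometry Q N)ᴴ * generator f * uniformIsometry Q N =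
      ((2 : ℂ) ^ width N)⁻¹ • addressMatrix f := by
  ext x x'
  rw [uniformIsometry, conjTranspose_adjoin_mul_mul_adjoin_apply]
  calc ∑ k, ∑ k', star (uniformState N k) * generator f (x, k) (x', k') * uniformState N k'
      = ∑ k : StepReg N, ∑ k', if k' = (k.1, !k.2) then
          if k.1 = (fun i => x (.inr i) ^^ x' (.inr i)) then
            (2 ^ (width N + 1))⁻¹ * addressMatrix f x x' else 0 else 0 := by
        refine Finset.sum_congr rfl fun k _ => Finset.sum_congr rfl fun k' _ => ?_
        rw [generator_apply hf, ← star_uniformState_mul k k', ite_and]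
        split_ifs <;> ring
    _ = ∑ _c : Bool, (2 ^ (width N + 1))⁻¹ * addressMatrix f x x' := by
        simp [Fintype.sum_prod_type, Finset.sum_add_distrib, two_mul]
    _ = ((2 : ℂ) ^ width N)⁻¹ * addressMatrix f x x' := by
        rw [Finset.sum_const, Finset.card_univ, Fintype.card_bool, nsmul_eq_mul, pow_succ]
        push_cast
        field_simp

end Compression

section Exponential

variable {m n : Type*} [Fintype m] [Fintype n] [DecidableEq m] [DecidableEq n]

open scoped Nat in
theorem norm_exp_sub_one_sub_le {𝔸 : Type*} [NormedRing 𝔸] [NormedAlgebra ℂ 𝔸] [CompleteSpace 𝔸]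
    {x : 𝔸} (hx : ‖x‖ ≤ 1) : ‖NormedSpace.exp x - 1 - x‖ ≤ ‖x‖ ^ 2 := by
  have hseries := (hasSum_nat_add_iff' 2).2 (NormedSpace.exp_series_hasSum_exp' (𝕂 := ℂ) x)
  have hseries' := (hasSum_nat_add_iff' 2).2 (NormedSpace.exp_series_hasSum_exp' (𝕂 := ℝ) ‖x‖)
  have htail := hseries.norm_le_of_bounded hseries' fun n => by
    rw [norm_smul, smul_eq_mul, norm_inv, Complex.norm_natCast]
    exact mul_le_mul_of_nonneg_left (norm_pow_le' x (by omega)) (by positivity)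
  simp only [Finset.sum_range_succ, Finset.sum_range_zero, Nat.factorial_zero, Nat.factorial_one,
    Nat.cast_one, inv_one, one_smul, pow_zero, pow_one, zero_add, ← Real.exp_eq_exp_ℝ] at htail
  rw [← sub_sub, ← sub_sub] at htail
  exact htail.trans ((le_abs_self _).trans
    (Real.abs_exp_sub_one_sub_id_le (x := ‖x‖) (by rwa [abs_norm])))

theorem exp_mul_of_mul_eq {X : Matrix m m ℂ} {Y : Matrix n n ℂ} {J : Matrix m n ℂ}
    (h : X * J = J * Y) : NormedSpace.exp X * J = J * NormedSpace.exp Y := by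
  have hpow (k : ℕ) : X ^ k * J = J * Y ^ k := by
    induction k with
    | zero => simp
    | succ k ih =>
      rw [pow_succ, pow_succ', Matrix.mul_assoc, h, ← Matrix.mul_assoc, ih, Matrix.mul_assoc,
        pow_mul_comm']
  have hleft := (NormedSpace.exp_series_hasSum_exp' (𝕂 := ℂ) X).map
    (AddMonoidHom.mk' (fun A : Matrix m m ℂ => A * J) fun a b => Matrix.add_mul a b J)
    (continuous_id.matrix_mul continuous_const)
  have hright := (NormedSpace.exp_series_hasSum_exp' (𝕂 := ℂ) Y).map
    (AddMonoidHom.mk' (fun A : Matrix n n ℂ => J * A) fun a b => Matrix.mul_add J a b)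
    (continuous_const.matrix_mul continuous_id)
  refine hleft.unique ?_
  convert! hright using 1
  funext k
  simp [hpow]

theorem norm_exp_neg_I_smul_le {H : Matrix n n ℂ} (hH : H.IsHermitian) :
    ‖NormedSpace.exp ((-Complex.I) • H)‖ ≤ 1 := by
  let +nondep : NormedAlgebra ℚ (Matrix n n ℂ) := .restrictScalars ℚ ℂ _
  have hself : IsSelfAdjoint H := hH
  have hunitary := NormedSpace.exp_mem_unitary_of_mem_skewAdjoint
    (hself.smul_mem_skewAdjoint (r := -Complex.I) (by simp [skewAdjoint.mem_iff]))
  exact norm_le_one_of_conjTranspose_mul_self (Unitary.mem_iff.1 hunitary).1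

end Exponential

section FirstOrder

variable {p q : Type*} [Fintype p] [Fintype q] [DecidableEq p] [DecidableEq q]

theorem conj_one_add_mul_isometry {J : Matrix p q ℂ} (hJ : Jᴴ * J = 1) {O' : Matrix p p ℂ}
    {O : Matrix q q ℂ} (hO : O' * J = J * O) (hO' : Jᴴ * O' = O * Jᴴ) (E : Matrix p p ℂ) :
    ((1 + E) * J)ᴴ * O' * ((1 + E) * J) =
      O + (Jᴴ * E * J)ᴴ * O + O * (Jᴴ * E * J) + Jᴴ * (Eᴴ * O' * E) * J := by
  have hfirst : Jᴴ * O' * J = O := by rw [hO', Matrix.mul_assoc, hJ, mul_one]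
  have hright : Jᴴ * O' * (E * J) = O * (Jᴴ * E * J) := by rw [hO']; simp only [Matrix.mul_assoc]
  have hleft : (E * J)ᴴ * O' * J = (Jᴴ * E * J)ᴴ * O := by
    rw [Matrix.mul_assoc, hO]
    simp only [Matrix.conjTranspose_mul, Matrix.conjTranspose_conjTranspose, Matrix.mul_assoc]
  have hlast : (E * J)ᴴ * O' * (E * J) = Jᴴ * (Eᴴ * O' * E) * J := by
    simp only [Matrix.conjTranspose_mul, Matrix.mul_assoc]
  rw [Matrix.add_mul, Matrix.one_mul, Matrix.conjTranspose_add, Matrix.add_mul, Matrix.add_mul,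
    Matrix.mul_add, Matrix.mul_add, hfirst, hright, hleft, hlast]
  abel

theorem norm_conjTranspose_mul_add_mul_le {D O : Matrix q q ℂ} {δ : ℝ} (hD : ‖D‖ ≤ δ) :
    ‖Dᴴ * O + O * D‖ ≤ 2 * δ * ‖O‖ :=
  calc ‖Dᴴ * O + O * D‖ ≤ ‖Dᴴ‖ * ‖O‖ + ‖O‖ * ‖D‖ :=
        norm_add_le_of_le (norm_mul_le _ _) (norm_mul_le _ _)
    _ = 2 * ‖D‖ * ‖O‖ := by rw [Matrix.l2_opNorm_conjTranspose]; ring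
    _ ≤ 2 * δ * ‖O‖ := by gcongr

theorem norm_conj_sub_first_order_le {J : Matrix p q ℂ} (hJ : Jᴴ * J = 1) {O' : Matrix p p ℂ}
    {O : Matrix q q ℂ} (hO : O' * J = J * O) (hO' : Jᴴ * O' = O * Jᴴ) (hnorm : ‖O'‖ ≤ ‖O‖)
    {T X : Matrix p p ℂ} {ρ η : ℝ} (hρ : ‖T - 1 - X‖ ≤ ρ) (hη : ‖T - 1‖ ≤ η) :
    ‖(T * J)ᴴ * O' * (T * J) - (O + (Jᴴ * X * J)ᴴ * O + O * (Jᴴ * X * J))‖ ≤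
      (2 * ρ + η ^ 2) * ‖O‖ := by
  have hJ1 := norm_le_one_of_conjTranspose_mul_self hJ
  obtain ⟨E, rfl⟩ : ∃ E, T = 1 + E := ⟨T - 1, (add_sub_cancel _ _).symm⟩
  rw [add_sub_cancel_left] at hρ hη
  have hremainder : ((1 + E) * J)ᴴ * O' * ((1 + E) * J) -
      (O + (Jᴴ * X * J)ᴴ * O + O * (Jᴴ * X * J)) =
        ((Jᴴ * (E - X) * J)ᴴ * O + O * (Jᴴ * (E - X) * J)) + Jᴴ * (Eᴴ * O' * E) * J := by
    rw [conj_one_add_mul_isometry hJ hO hO', Matrix.mul_sub, Matrix.sub_mul,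
      Matrix.conjTranspose_sub, Matrix.sub_mul, Matrix.mul_sub]
    abel
  have hquadratic : ‖Jᴴ * (Eᴴ * O' * E) * J‖ ≤ η ^ 2 * ‖O‖ :=
    calc ‖Jᴴ * (Eᴴ * O' * E) * J‖ ≤ ‖Eᴴ * O' * E‖ := norm_conjTranspose_mul_mul_le hJ1 _
      _ ≤ ‖Eᴴ‖ * ‖O'‖ * ‖E‖ := norm_mul₃_le
      _ = ‖E‖ ^ 2 * ‖O'‖ := by rw [Matrix.l2_opNorm_conjTranspose]; ring
      _ ≤ η ^ 2 * ‖O‖ := by gcongr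
  rw [hremainder, add_mul]
  exact norm_add_le_of_le (norm_conjTranspose_mul_add_mul_le
    ((norm_conjTranspose_mul_mul_le hJ1 _).trans hρ)) hquadratic

variable {ι κ : Type*} [Fintype ι] [Fintype κ] [DecidableEq κ]

/-- In the Heisenberg picture and in the operator norm, the channel with the Kraus operators `K i`
agrees up to the error `e` with `O ↦ O + Xᴴ O + O X`, also in the presence of a reference system. -/
def ActsToFirstOrder (K : ι → Matrix q q ℂ) (X : Matrix q q ℂ) (e : ℝ) : Prop :=
  ∀ (r : ℕ) (O : Matrix (Fin r × q) (Fin r × q) ℂ),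
    ‖krausDual K O - (O + (amplify (Fin r) X)ᴴ * O + O * amplify (Fin r) X)‖ ≤ e * ‖O‖

theorem actsToFirstOrder_rows {v : κ → ℂ} (hv : ∑ k, ‖v k‖ ^ 2 = 1)
    {T X : Matrix (q × κ) (q × κ) ℂ} {ρ η : ℝ} (hρ : ‖T - 1 - X‖ ≤ ρ) (hη : ‖T - 1‖ ≤ η) :
    ActsToFirstOrder (fun k => (T * adjoin q v).submatrix (·, k) id)
      ((adjoin q v)ᴴ * X * adjoin q v) (2 * ρ + η ^ 2) := by
  intro r O
  have hJ : (amplify (Fin r) (adjoin q v))ᴴ * amplify (Fin r) (adjoin q v) = 1 := by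
    rw [← amplify_conjTranspose, ← amplify_mul, conjTranspose_adjoin_mul_self hv, amplify_one]
  rw [krausDual_rows, amplify_mul, amplify_mul, amplify_mul, amplify_conjTranspose]
  refine norm_conj_sub_first_order_le hJ (extendObservable_mul_adjoin v O)
    (conjTranspose_adjoin_mul_extendObservable v O) (norm_extendObservable_le O) ?_ ?_
  · rw [← amplify_one, ← amplify_sub, ← amplify_sub]
    exact (norm_amplify_le _).trans hρ
  · rw [← amplify_one, ← amplify_sub]
    exact (norm_amplify_le _).trans hη

theorem ActsToFirstOrder.congr {K : ι → Matrix q q ℂ} {X X' : Matrix q q ℂ} {e δ : ℝ}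
    (h : ActsToFirstOrder K X e) (hX : ‖X - X'‖ ≤ δ) : ActsToFirstOrder K X' (e + 2 * δ) := by
  intro r O
  have hdiff := norm_conjTranspose_mul_add_mul_le (O := O)
    ((norm_amplify_le (R := Fin r) (X - X')).trans hX)
  have hsplit : krausDual K O - (O + (amplify (Fin r) X')ᴴ * O + O * amplify (Fin r) X') =
      (krausDual K O - (O + (amplify (Fin r) X)ᴴ * O + O * amplify (Fin r) X)) +
        ((amplify (Fin r) (X - X'))ᴴ * O + O * amplify (Fin r) (X - X')) := by
    rw [amplify_sub, Matrix.conjTranspose_sub, Matrix.sub_mul, Matrix.mul_sub]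
    abel
  rw [hsplit, add_mul]
  exact norm_add_le_of_le (h r O) hdiff

theorem ActsToFirstOrder.approximates_exp {K : ι → Matrix q q ℂ} {X : Matrix q q ℂ} {e m : ℝ}
    (h : ActsToFirstOrder K X e) (hm : m ≤ 1) (hX : ‖X‖ ≤ m) :
    Approximates K (NormedSpace.exp X) (e + 6 * m ^ 2) := by
  intro r O
  set V := NormedSpace.exp X
  have hm0 : 0 ≤ m := (norm_nonneg _).trans hX
  have hV : ‖V - 1 - X‖ ≤ m ^ 2 :=
    (norm_exp_sub_one_sub_le (hX.trans hm)).trans (pow_le_pow_left₀ (norm_nonneg _) hX 2)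
  have hV1 : ‖V - 1‖ ≤ 2 * m :=
    calc ‖V - 1‖ = ‖(V - 1 - X) + X‖ := by rw [sub_add_cancel]
      _ ≤ m ^ 2 + m := norm_add_le_of_le hV hX
      _ ≤ 2 * m := by nlinarith
  have hexp := norm_conj_sub_first_order_le (J := (1 : Matrix (Fin r × q) (Fin r × q) ℂ)) (O' := O)
    (O := O) (T := amplify (Fin r) V) (X := amplify (Fin r) X) (ρ := m ^ 2) (η := 2 * m)
    (by simp) (by simp) (by simp) le_rfl
    (by
      rw [← amplify_one, ← amplify_sub, ← amplify_sub]
      exact (norm_amplify_le _).trans hV)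
    (by
      rw [← amplify_one, ← amplify_sub]
      exact (norm_amplify_le _).trans hV1)
  simp only [mul_one, Matrix.conjTranspose_one, one_mul] at hexp
  calc _ ≤ e * ‖O‖ + (2 * m ^ 2 + (2 * m) ^ 2) * ‖O‖ := by
        refine (norm_sub_le_norm_sub_add_norm_sub _ _ _).trans (add_le_add (h r O) ?_)
        rwa [norm_sub_rev]
    _ = (e + 6 * m ^ 2) * ‖O‖ := by ring

end FirstOrder

section StepEvolution

variable {Q N b : ℕ} {f : Address Q N → ℂ} {m δ u : ℝ}

theorem isHermitian_generator (f : Address Q N → ℂ) : (generator f).IsHermitian := by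
  ext s s'
  simp only [Matrix.conjTranspose_apply, generator, Matrix.diagonal_mul, basisMap_apply]
  by_cases h : s = exchange s'
  · subst h
    have hflag : (exchange s').2.2 = !s'.2.2 := rfl
    rw [if_pos (exchange_involutive s').symm, if_pos rfl, loadedAddress_exchange, hflag]
    cases s'.2.2 <;> simp
  · have h' : s' ≠ exchange s := fun e => h (by rw [e, exchange_involutive])
    rw [if_neg h, if_neg h', mul_zero, mul_zero, star_zero]

/-- The evolution that a step approximates. -/
noncomputable def stepEvolution (f : Address Q N → ℂ) :
    Matrix (SysWire Q N → Bool) (SysWire Q N → Bool) ℂ :=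
  NormedSpace.exp ((-Complex.I) •
    ((uniformIsometry Q N)ᴴ * generator f * uniformIsometry Q N))

theorem norm_stepEvolution_le (f : Address Q N → ℂ) : ‖stepEvolution f‖ ≤ 1 :=
  norm_exp_neg_I_smul_le (Matrix.isHermitian_conjTranspose_mul_mul _ (isHermitian_generator f))

theorem norm_neg_I_smul_compression_le {X : Matrix ((SysWire Q N → Bool) × StepReg N)
    ((SysWire Q N → Bool) × StepReg N) ℂ} (hX : ‖X‖ ≤ m) :
    ‖(-Complex.I) • ((uniformIsometry Q N)ᴴ * X * uniformIsometry Q N)‖ ≤ m := by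
  rw [norm_smul, norm_neg, Complex.norm_I, one_mul]
  exact (norm_conjTranspose_mul_mul_le (norm_le_one_of_conjTranspose_mul_self
    conjTranspose_uniformIsometry_mul_self) X).trans hX

theorem actsToFirstOrder_stepCircuit (Z : Table Q N b) (hm : 0 ≤ m) (hm1 : m ≤ 1)
    (hZ : ∀ a, ‖(Z.word a).value u‖ ≤ m) :
    ActsToFirstOrder ((stepCircuit Q N b u).kraus Z)
      ((-Complex.I) • ((uniformIsometry Q N)ᴴ * generator (fun a => (Z.word a).value u) *
        uniformIsometry Q N)) (61 * m ^ 2) := by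
  set X := (-Complex.I) • generator fun a => (Z.word a).value u
  have hX : ‖X‖ ≤ m := by
    rw [norm_smul, norm_neg, Complex.norm_I, one_mul]
    exact norm_generator_le hm hZ
  have hT : ‖stepMatrix Z u - 1 - X‖ ≤ 6 * m ^ 2 := norm_stepMatrix_sub_le Z u hm hm1 hZ
  have hT1 : ‖stepMatrix Z u - 1‖ ≤ 7 * m :=
    calc ‖stepMatrix Z u - 1‖ = ‖(stepMatrix Z u - 1 - X) + X‖ := by rw [sub_add_cancel]
      _ ≤ 6 * m ^ 2 + m := norm_add_le_of_le hT hX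
      _ ≤ 7 * m := by nlinarith
  intro r O
  have hrows := actsToFirstOrder_rows sum_norm_uniformState_sq hT hT1 r O
  rw [← uniformIsometry, ← krausDual_stepCircuit] at hrows
  rw [← Matrix.smul_mul, ← Matrix.mul_smul]
  exact hrows.trans_eq (by ring)

theorem approximates_stepEvolution (Z : Table Q N b) (hm : 0 ≤ m) (hm1 : m ≤ 1) (hδ : 0 ≤ δ)
    (hZ : ∀ a, ‖(Z.word a).value u‖ ≤ m) (hf : ∀ a, ‖f a‖ ≤ m)
    (hZf : ∀ a, ‖(Z.word a).value u - f a‖ ≤ δ) :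
    Approximates ((stepCircuit Q N b u).kraus Z) (stepEvolution f) (67 * m ^ 2 + 2 * δ) := by
  have hdiff : ‖(-Complex.I) • ((uniformIsometry Q N)ᴴ * generator (fun a => (Z.word a).value u) *
      uniformIsometry Q N) - (-Complex.I) • ((uniformIsometry Q N)ᴴ * generator f *
        uniformIsometry Q N)‖ ≤ δ := by
    rw [← smul_sub, ← Matrix.sub_mul, ← Matrix.mul_sub, generator_sub]
    exact norm_neg_I_smul_compression_le (norm_generator_le hδ hZf)
  have h := ((actsToFirstOrder_stepCircuit Z hm hm1 hZ).congr hdiff).approximates_exp hm1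
    (norm_neg_I_smul_compression_le (norm_generator_le hm hf))
  rwa [show 61 * m ^ 2 + 2 * δ + 6 * m ^ 2 = 67 * m ^ 2 + 2 * δ by ring] at h

theorem isContractive_stepCircuit (Z : Table Q N b) (u : ℝ) :
    IsContractive ((stepCircuit Q N b u).kraus Z) := by
  intro r O
  rw [krausDual_stepCircuit]
  refine isContractive_rows ?_ r O
  exact (Matrix.l2_opNorm_mul _ _).trans (mul_le_one₀ (norm_stepMatrix_le Z u) (norm_nonneg _)
    (norm_le_one_of_conjTranspose_mul_self conjTranspose_uniformIsometry_mul_self))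

end StepEvolution

section Encoding

variable {Q N : ℕ} {A : Fin Q → Matrix (Fin N) (Fin N) ℂ} {t : ℝ} {n : ℕ}

/-- The entries of the matrices, as a function of addresses that vanishes out of range. -/
noncomputable def paddedEntry (A : Fin Q → Matrix (Fin N) (Fin N) ℂ) (a : Address Q N) : ℂ :=
  if h : Nat.ofBits a.1 < Q ∧ Nat.ofBits a.2.1 < N ∧ Nat.ofBits a.2.2 < N then
    A ⟨Nat.ofBits a.1, h.1⟩ ⟨Nat.ofBits a.2.1, h.2.1⟩ ⟨Nat.ofBits a.2.2, h.2.2⟩ else 0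

theorem star_paddedEntry (hA : ∀ q, (A q).IsHermitian) (q : Fin (width Q) → Bool)
    (i j : Fin (width N) → Bool) : star (paddedEntry A (q, i, j)) = paddedEntry A (q, j, i) := by
  by_cases h : Nat.ofBits q < Q ∧ Nat.ofBits i < N ∧ Nat.ofBits j < N
  · rw [paddedEntry, paddedEntry, dif_pos h, dif_pos ⟨h.1, h.2.2, h.2.1⟩]
    exact (hA _).apply _ _
  · rw [paddedEntry, paddedEntry, dif_neg h, dif_neg fun h' => h ⟨h'.1, h'.2.2, h'.2.1⟩, star_zero]

theorem paddedEntry_label (A : Fin Q → Matrix (Fin N) (Fin N) ℂ) (q : Fin Q) (i j : Fin N) :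
    paddedEntry A (label (width Q) q, label (width N) i, label (width N) j) = A q i j := by
  simp [paddedEntry, ofBits_label]

theorem label_ofBits {k : ℕ} (x : Fin k → Bool) : label k (Nat.ofBits x) = x := by
  funext i
  simp [label]

/-- The isometry that encodes the block `|q⟩ ⊗ ℂ^N` in the system qubits. -/
def encodeBlock (N : ℕ) (q : Fin Q) : Matrix (SysWire Q N → Bool) (Fin N) ℂ :=
  basisMap fun j => sysLabel (q, j)

theorem addressMatrix_paddedEntry_mul_encodeBlock (A : Fin Q → Matrix (Fin N) (Fin N) ℂ)
    (q : Fin Q) : addressMatrix (paddedEntry A) * encodeBlock N q = encodeBlock N q * A q := by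
  have hinj : (fun j : Fin N => (sysLabel (q, j) : SysWire Q N → Bool)).Injective :=
    sysLabel_injective.comp (Prod.mk_right_injective q)
  ext x j
  rw [encodeBlock, mul_basisMap_apply]
  by_cases hx : x ∈ Set.range fun i : Fin N => (sysLabel (q, i) : SysWire Q N → Bool)
  · obtain ⟨i, rfl⟩ := hx
    rw [basisMap_mul_apply_of_injective hinj, addressMatrix, ← paddedEntry_label A]
    exact if_pos rfl
  · rw [basisMap_mul_apply_of_notMem_range hx, addressMatrix, ite_eq_right_iff]
    intro hq
    rw [paddedEntry, dif_neg]
    rintro ⟨-, hi, -⟩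
    refine hx ⟨⟨_, hi⟩, ?_⟩
    exact (congrArg₂ Sum.elim hq (label_ofBits (x ∘ Sum.inr)).symm).symm.trans
      (Sum.elim_comp_inl_inr x)

theorem parallelEvolution_apply (A : Fin Q → Matrix (Fin N) (Fin N) ℂ) (t : ℝ) (q q' : Fin Q)
    (i j : Fin N) : parallelEvolution A t (q, i) (q', j) =
      if q = q' then NormedSpace.exp ((-Complex.I * (t / N : ℂ)) • A q') i j else 0 := by
  rw [parallelEvolution, Matrix.sum_apply, Finset.sum_eq_single q']
  · simp [Matrix.kroneckerMap_apply, Matrix.single_apply, eq_comm]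
  · intro p _ hp
    simp [Matrix.kroneckerMap_apply, hp]
  · simp

theorem exp_addressMatrix_mul_encodeMatrix (A : Fin Q → Matrix (Fin N) (Fin N) ℂ) (t : ℝ) :
    NormedSpace.exp ((-Complex.I * (t / N : ℂ)) • addressMatrix (paddedEntry A)) *
      encodeMatrix Q N = encodeMatrix Q N * parallelEvolution A t := by
  set c := -Complex.I * (t / N : ℂ)
  ext x ⟨q, j⟩
  have hblock := exp_mul_of_mul_eq (X := c • addressMatrix (paddedEntry A)) (Y := c • A q)
    (J := encodeBlock N q)
    (by rw [Matrix.smul_mul, Matrix.mul_smul, addressMatrix_paddedEntry_mul_encodeBlock])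
  have hentry := congrFun₂ hblock x j
  rw [encodeBlock, mul_basisMap_apply, Matrix.mul_apply] at hentry
  rw [encodeMatrix, mul_basisMap_apply, hentry, Matrix.mul_apply, Fintype.sum_prod_type]
  simp [parallelEvolution_apply, basisMap_apply, c]

/-- The factor by which a step scales the entries. The compression to the system divides by
`2 ^ width N`, so that `n` steps amount to the factor `t / N`. -/
noncomputable def stepScale (N : ℕ) (t : ℝ) (n : ℕ) : ℝ := t / n * (2 ^ width N / N)

theorem stepEvolution_pow_mul_encodeMatrix (hA : ∀ q, (A q).IsHermitian) (t : ℝ) (hn : n ≠ 0) :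
    stepEvolution ((stepScale N t n : ℂ) • paddedEntry A) ^ n * encodeMatrix Q N =
      encodeMatrix Q N * parallelEvolution A t := by
  set s := stepScale N t n with hs
  have hf (q : Fin (width Q) → Bool) (i j : Fin (width N) → Bool) :
      star (((s : ℂ) • paddedEntry A) (q, i, j)) = ((s : ℂ) • paddedEntry A) (q, j, i) := by
    simp [star_paddedEntry hA]
  have hsmul : addressMatrix ((s : ℂ) • paddedEntry A) =
      (s : ℂ) • addressMatrix (paddedEntry A) := by
    ext x x'
    simp [addressMatrix]
  have hcoeff : (n : ℂ) * (-Complex.I * (2 ^ width N)⁻¹ * s) = -Complex.I * (t / N) := by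
    have hn' : (n : ℂ) ≠ 0 := mod_cast hn
    rw [hs, stepScale]
    push_cast
    field_simp
  rw [stepEvolution, ← Matrix.exp_nsmul, compression_generator hf, hsmul, smul_smul, smul_smul,
    ← Nat.cast_smul_eq_nsmul ℂ, smul_smul, hcoeff, exp_addressMatrix_mul_encodeMatrix]

end Encoding

section Width

variable {N : ℕ}

theorem two_pow_width_div_le (hN : 0 < N) : (2 : ℝ) ^ width N / N ≤ 2 := by
  rw [div_le_iff₀ (mod_cast hN)]
  suffices h : 2 ^ width N ≤ 2 * N from mod_cast h
  rcases (Nat.succ_le_of_lt hN).eq_or_lt with rfl | hN1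
  · simp [width]
  · have hpred : width N = (Nat.clog 2 N).pred + 1 :=
      (Nat.succ_pred_eq_of_pos (Nat.clog_pos one_lt_two hN1)).symm
    have hlt := Nat.pow_pred_clog_lt_self one_lt_two hN1
    rw [hpred, pow_succ]
    omega

theorem width_le (N : ℕ) : (width N : ℝ) ≤ 1 + 2 * Real.log N := by
  have hlog : 0 ≤ Real.log N := Real.log_natCast_nonneg N
  have hlogb0 : 0 ≤ Real.logb 2 N := div_nonneg hlog (Real.log_nonneg one_le_two)
  have hceil : width N = ⌈Real.logb 2 N⌉₊ := mod_cast (Real.natCeil_logb_natCast 2 N).symm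
  have hlogb : Real.logb 2 N ≤ 2 * Real.log N := by
    rw [Real.logb, div_le_iff₀ (Real.log_pos one_lt_two)]
    nlinarith [Real.log_two_gt_d9]
  rw [hceil]
  linarith [Nat.ceil_lt_add_one hlogb0]

end Width

section Entries

variable {Q N b n : ℕ} {A : Fin Q → Matrix (Fin N) (Fin N) ℂ} {Z : Table Q N b} {u t ε M : ℝ}

theorem norm_entry_le_maxAbsEntry (A : Fin Q → Matrix (Fin N) (Fin N) ℂ) (q : Fin Q) (i j : Fin N) :
    ‖A q i j‖ ≤ maxAbsEntry A :=
  le_ciSup (f := fun p : Fin Q × Fin N × Fin N => ‖A p.1 p.2.1 p.2.2‖)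
    (Set.finite_range _).bddAbove (q, i, j)

theorem norm_paddedEntry_le (hM : 0 ≤ M) (hA : maxAbsEntry A ≤ M) (a : Address Q N) :
    ‖paddedEntry A a‖ ≤ M := by
  unfold paddedEntry
  split_ifs
  · exact (norm_entry_le_maxAbsEntry A _ _ _).trans hA
  · rwa [norm_zero]

theorem mul_norm_value_word_sub_paddedEntry_le {c : ℝ} (hε : 0 ≤ ε)
    (hZ : ∀ q i j, c * ‖A q i j - (Z q i j).value u‖ ≤ ε) (a : Address Q N) :
    c * ‖(Z.word a).value u - paddedEntry A a‖ ≤ ε := by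
  unfold Table.word Table.lookup paddedEntry
  split_ifs
  · rw [norm_sub_rev]
    exact hZ _ _ _
  · have hzero : Word.value u ((fun _ => false, fun _ => false) : Word b) = 0 := by
      apply Complex.ext <;> simp [Word.value, fixedPoint]
    rwa [hzero, sub_zero, norm_zero, mul_zero]

theorem value_mul (s u : ℝ) (z : Word b) : z.value (s * u) = (s : ℂ) * z.value u := by
  apply Complex.ext <;> simp [Word.value, fixedPoint, mul_assoc]

theorem abs_stepScale_le (hN : 0 < N) (t : ℝ) (n : ℕ) : |stepScale N t n| ≤ 2 * |t| / n := by
  have hratio : (0 : ℝ) ≤ 2 ^ width N / N := by positivity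
  calc |stepScale N t n| = |t| / n * (2 ^ width N / N) := by
        rw [stepScale, abs_mul, abs_div, Nat.abs_cast, abs_of_nonneg hratio]
    _ ≤ |t| / n * 2 := by gcongr; exact two_pow_width_div_le hN
    _ = 2 * |t| / n := by ring

theorem norm_stepScale_smul_paddedEntry_le (hN : 0 < N) (hM : 0 ≤ M) (hA : maxAbsEntry A ≤ M)
    (t : ℝ) (n : ℕ) (a : Address Q N) :
    ‖((stepScale N t n : ℂ) • paddedEntry A) a‖ ≤ 2 * |t| / n * M := by
  rw [Pi.smul_apply, norm_smul, Complex.norm_real, Real.norm_eq_abs]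
  exact mul_le_mul (abs_stepScale_le hN t n) (norm_paddedEntry_le hM hA a) (norm_nonneg _)
    (by positivity)

theorem norm_value_stepScale_mul_sub_le (hN : 0 < N) (hε : 0 ≤ ε)
    (hZ : ∀ q i j, 8 * |t| * ‖A q i j - (Z q i j).value u‖ ≤ ε) (n : ℕ) (a : Address Q N) :
    ‖(Z.word a).value (stepScale N t n * u) - ((stepScale N t n : ℂ) • paddedEntry A) a‖ ≤
      ε / (4 * n) := by
  set d := ‖(Z.word a).value u - paddedEntry A a‖
  calc _ = |stepScale N t n| * d := by
        rw [value_mul, Pi.smul_apply, smul_eq_mul, ← mul_sub, norm_mul, Complex.norm_real,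
          Real.norm_eq_abs]
    _ ≤ 2 * |t| / n * d := by gcongr; exact abs_stepScale_le hN t n
    _ = (8 * |t| * d) / (4 * n) := by ring
    _ ≤ ε / (4 * n) := by gcongr; exact mul_norm_value_word_sub_paddedEntry_le hε hZ a

end Entries

theorem mul_step_sq_le {n x ε μ m : ℝ} (hε : 0 < ε) (hε2 : ε ≤ 2) (hμ : 1 ≤ μ)
    (hx : x ^ 2 ≤ μ * ε) (hn : 1200 * μ ≤ n) (hm : n * m = 2 * x + ε / 4) :
    n * m ^ 2 ≤ ε / 140 := by
  have hμ0 : 0 < μ := by linarith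
  have hsq : (n * m) ^ 2 ≤ 8.25 * (μ * ε) := by
    rw [hm]
    nlinarith [sq_nonneg (2 * x - ε / 4)]
  have hnm : μ * (1200 * (n * m ^ 2)) ≤ μ * (8.25 * ε) :=
    calc μ * (1200 * (n * m ^ 2)) = 1200 * μ * (n * m ^ 2) := by ring
      _ ≤ n * (n * m ^ 2) := by
        have hn0 : 0 ≤ n := by linarith
        gcongr
      _ = (n * m) ^ 2 := by ring
      _ ≤ μ * (8.25 * ε) := by linarith
  linarith [le_of_mul_le_mul_left hnm hμ0]

section Simulation

variable {Q N b : ℕ} {A : Fin Q → Matrix (Fin N) (Fin N) ℂ} {Z : Table Q N b} {u t ε M : ℝ} {n : ℕ}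

theorem simulates_iterate (hN : 0 < N) (hε : 0 < ε) (hε2 : ε ≤ 2) (hM : 0 ≤ M)
    (hn : 1200 * max 1 (M ^ 2 * t ^ 2 / ε) ≤ n) (hA : ∀ q, (A q).IsHermitian)
    (hAM : maxAbsEntry A ≤ M) (hZ : ∀ q i j, 8 * |t| * ‖A q i j - (Z q i j).value u‖ ≤ ε) :
    ((stepCircuit Q N b (stepScale N t n * u)).iterate n).Simulates Z
      (parallelEvolution A t) ε := by
  set μ := max 1 (M ^ 2 * t ^ 2 / ε)
  have hμ : 1 ≤ μ := le_max_left _ _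
  have hx : (|t| * M) ^ 2 ≤ μ * ε := by
    rw [mul_pow, sq_abs, mul_comm]
    exact (div_le_iff₀ hε).1 (le_max_right _ _)
  have hn1 : (1 : ℝ) ≤ n := by linarith
  have hn0 : n ≠ 0 := by
    rintro rfl
    norm_num at hn1
  set δ := ε / (4 * n) with hδ
  set m := 2 * |t| / n * M + δ with hm
  have hδ0 : 0 ≤ δ := by positivity
  have hm0 : 0 ≤ m := by positivity
  have hnm : n * m ^ 2 ≤ ε / 140 := by
    refine mul_step_sq_le hε hε2 hμ hx hn ?_
    rw [hm, hδ]
    field_simp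
  have hm1 : m ≤ 1 := by nlinarith
  have hdiff := norm_value_stepScale_mul_sub_le hN hε.le hZ n
  have hpadded := norm_stepScale_smul_paddedEntry_le hN hM hAM t n
  have hstep := approximates_stepEvolution Z hm0 hm1 hδ0
    (fun a => (norm_le_norm_sub_add _ _).trans
      ((add_le_add (hdiff a) (hpadded a)).trans_eq (add_comm _ _)))
    (fun a => (hpadded a).trans (le_add_of_nonneg_right hδ0)) hdiff
  refine ((Circuit.approximates_iterate hstep (norm_stepEvolution_le _) (by positivity)
    (isContractive_stepCircuit Z _) n).mono ?_).simulates hε.le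
    (stepEvolution_pow_mul_encodeMatrix hA t hn0)
  calc n * (67 * m ^ 2 + 2 * δ) = 67 * (n * m ^ 2) + ε / 2 := by rw [hδ]; field_simp; ring
    _ ≤ ε := by linarith

theorem simulates_empty (hε : 2 ≤ ε) (hA : ∀ q, (A q).IsHermitian) (Z : Table Q N b) (t : ℝ) :
    (Circuit.empty : Circuit Q N b).Simulates Z (parallelEvolution A t) ε := by
  have hencode := stepEvolution_pow_mul_encodeMatrix hA t one_ne_zero
  rw [pow_one] at hencode
  refine (((Circuit.approximates_empty Z).of_norm_le_one ?_ (norm_stepEvolution_le _)).mono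
    ?_).simulates (by linarith) hencode
  · exact norm_le_one_of_conjTranspose_mul_self (by simp)
  · linarith

theorem time_iterate_stepCircuit_le {τ : ℕ} {c₀ v μ : ℝ} {k₀ : ℕ} (hQ : 0 < Q) (hN : 0 < N)
    (hb : 2 * (b + 1) ≤ τ) (hτ : (τ : ℝ) ≤ c₀ * (1 + Real.log ((N : ℝ) ^ 2 * Q)) ^ k₀)
    (hμ : 1 ≤ μ) (hn : (n : ℝ) ≤ 1200 * μ + 1) :
    (((stepCircuit Q N b v).iterate n).time τ : ℝ) ≤
      1201 * (8 + 4 * |c₀|) * μ * (1 + Real.log ((N : ℝ) ^ 2 * Q)) ^ (k₀ + 1) := by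
  have hlogQ : 0 ≤ Real.log Q := Real.log_natCast_nonneg Q
  have hlogN : 0 ≤ Real.log N := Real.log_natCast_nonneg N
  have hlog : Real.log ((N : ℝ) ^ 2 * Q) = 2 * Real.log N + Real.log Q := by
    rw [Real.log_mul (by positivity) (by positivity), Real.log_pow, Nat.cast_ofNat]
  set L := 1 + Real.log ((N : ℝ) ^ 2 * Q)
  have hL : 1 ≤ L := by linarith
  have hwidth : (width N : ℝ) ≤ L := by linarith [width_le N]
  have hpow : L ≤ L ^ (k₀ + 1) := le_self_pow₀ hL (by omega)
  have hword : (2 : ℝ) * (b + 1) ≤ τ := by exact_mod_cast hb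
  have horacle : (τ : ℝ) ≤ |c₀| * L ^ (k₀ + 1) :=
    hτ.trans (mul_le_mul (le_abs_self _) (pow_le_pow_right₀ hL (by omega)) (by positivity)
      (abs_nonneg _))
  rw [Circuit.time_iterate, time_stepCircuit]
  push_cast
  calc (n : ℝ) * (6 * (width N : ℝ) + 4 * (b + 1) + 2 + 2 * τ)
      ≤ 1201 * μ * ((8 + 4 * |c₀|) * L ^ (k₀ + 1)) := by
        gcongr
        · linarith
        · linarith
    _ = 1201 * (8 + 4 * |c₀|) * μ * L ^ (k₀ + 1) := by ring

end Simulation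

end ParHamSim

open ParHamSim in
theorem theorem1 (c₀ : ℝ) (k₀ : ℕ) :
    ∃ (C : ℝ) (k : ℕ), ∀ (Q N b τ : ℕ) (u M t ε : ℝ),
      0 < Q → 0 < N → 0 < ε → 2 * (b + 1) ≤ τ →
      (τ : ℝ) ≤ c₀ * (1 + Real.log ((N : ℝ) ^ 2 * Q)) ^ k₀ →
      ∃ c : Circuit Q N b,
        (c.time τ : ℝ) ≤ C * max 1 (M ^ 2 * t ^ 2 / ε) * (1 + Real.log ((N : ℝ) ^ 2 * Q)) ^ k ∧
        ∀ A : Fin Q → Matrix (Fin N) (Fin N) ℂ, (∀ q, (A q).IsHermitian) → maxAbsEntry A ≤ M →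
          ∀ Z : Table Q N b,
            (∀ q i j, 8 * |t| * ‖A q i j - (Z q i j).value u‖ ≤ ε) →
            c.Simulates Z (parallelEvolution A t) ε := by
  refine ⟨1201 * (8 + 4 * |c₀|), k₀ + 1, fun Q N b τ u M t ε hQ hN hε hb hτ => ?_⟩
  set μ := max 1 (M ^ 2 * t ^ 2 / ε)
  have hμ : 1 ≤ μ := le_max_left _ _
  rcases le_total 2 ε with hε2 | hε2
  · refine ⟨Circuit.empty, ?_, fun A hA _ Z _ => simulates_empty hε2 hA Z t⟩
    exact time_iterate_stepCircuit_le (v := u) (n := 0) hQ hN hb hτ hμ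
      (by rw [Nat.cast_zero]; positivity)
  · set n := ⌈1200 * μ⌉₊
    refine ⟨(stepCircuit Q N b (stepScale N t n * u)).iterate n,
      time_iterate_stepCircuit_le hQ hN hb hτ hμ (Nat.ceil_lt_add_one (by positivity)).le,
      fun A hA hAM Z hZ => ?_⟩
    have hM : 0 ≤ M :=
      (norm_nonneg _).trans ((norm_entry_le_maxAbsEntry A ⟨0, hQ⟩ ⟨0, hN⟩ ⟨0, hN⟩).trans hAM)
    exact simulates_iterate hN hε hε2 hM (Nat.le_ceil _) hA hAM hZ
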